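/- Individual players arrive at a queue according to a Poisson process with rate $\lambda_1>0$, and, independently, teams of two players arrive according to a Poisson process with rate $\lambda_2\ge 0$; put $\lambda_{\text{total}}=\lambda_1+2\lambda_2$, the total arrival rate of players. The queue is empty initially. Each game is played by exactly four waiting players, the two players of a team always play in the same game, and no player plays twice. Consider any matchmaking mechanism (possibly randomized) which starts a game as soon as there are at least four players in the queue, so that four or more players are never left waiting. The waiting time of a player is the time from its arrival to the start of its game. Then, whatever the mechanism, the expected waiting time $\mathbb{E}[T]$ over all players is $$\mathbb{E}[T]=\frac{3}{2\lambda_{\text{total}}},$$ where $\mathbb{E}[T]$ is the long-run average waiting time of all players, in both of the following senses: as $t\to\infty$, the average of the waiting times of all players who arrive during $[0,t]$ converges to $\frac{3}{2\lambda_{\text{total}}}$ almost surely; and the expected sum of the waiting times of all players who arrive during $[0,t]$, divided by the expected number of these players, converges to $\frac{3}{2\lambda_{\text{total}}}$. -/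

import Mathlib

open MeasureTheory ProbabilityTheory Filter Topology
open scoped NNReal ENNReal

namespace TwoVTwo

noncomputable section

/-- `A t ω` is the number of arrivals in the time interval `[0, t]`. The process `A` is a (homogeneous)
Poisson process of rate `r`: a counting process started at `0`, with independent increments, whose
increment over a time interval of length `h` has the Poisson law of mean `r * h`.
(Rate `0` is allowed: almost surely there are no arrivals.) -/
structure IsPoissonProcess {Ω : Type*} [MeasurableSpace Ω] (A : ℝ≥0 → Ω → ℕ) (r : ℝ≥0)
    (P : Measure Ω) : Prop where
  measurable : ∀ t, Measurable (A t)
  zero : ∀ ω, A 0 ω = 0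
  mono : ∀ ω, Monotone fun t => A t ω
  rightCont : ∀ ω t, ContinuousWithinAt (fun s => A s ω) (Set.Ici t) t
  indepIncrements : HasIndepIncrements A P
  law : ∀ s h : ℝ≥0, HasLaw (fun ω => A (s + h) ω - A s ω) (poissonMeasure (r * h)) P

/-- The arriving parties: `Sum.inl k` is the `k`-th individual arrival (one player), `Sum.inr k` is
the `k`-th team arrival (two players), counting from `k = 0`. -/
abbrev Party : Type := ℕ ⊕ ℕ

/-- The number of players in a party. -/
def Party.size : Party → ℕ
  | Sum.inl _ => 1
  | Sum.inr _ => 2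

/-- The time of the `k`-th jump (from `k = 0`) of a counting path, `∞` if there is no such jump. -/
def jumpTime (a : ℝ≥0 → ℕ) (k : ℕ) : ℝ≥0∞ :=
  ⨅ (t : ℝ≥0) (_ : k < a t), (t : ℝ≥0∞)

/-- The arrival time of a party, when `a₁ t` individuals and `a₂ t` teams have arrived by time `t`.
It is `∞` for a party that never arrives. -/
def arrival (a₁ a₂ : ℝ≥0 → ℕ) : Party → ℝ≥0∞
  | Sum.inl k => jumpTime a₁ k
  | Sum.inr k => jumpTime a₂ k

/-- A game: the parties that play it and the time at which it starts. -/
structure Game where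
  members : Finset Party
  start : ℝ≥0

/-- The time at which a party leaves the queue, i.e. the start of the game that it plays, when
`games` is the set of all games that take place; `∞` if it never plays. -/
def departure (games : Set Game) (p : Party) : ℝ≥0∞ :=
  ⨅ (g ∈ games) (_ : p ∈ g.members), (g.start : ℝ≥0∞)

open Classical in
/-- The number of players who are waiting in the queue at time `t`, after the games that start at
time `t` have begun: they have arrived by time `t` and not left by time `t`. -/
def queueLength (a₁ a₂ : ℝ≥0 → ℕ) (games : Set Game) (t : ℝ≥0) : ℝ≥0∞ :=
  ∑' p : Party,
    if arrival a₁ a₂ p ≤ t ∧ t < departure games p then (p.size : ℝ≥0∞) else 0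

/-- `games` is a possible outcome of a 2v2 matchmaking mechanism which starts a game as soon as there
are at least four players in the queue, for the arrival paths `a₁` (individuals) and `a₂` (teams). -/
structure IsMatchmaking (a₁ a₂ : ℝ≥0 → ℕ) (games : Set Game) : Prop where
  /-- A game is played by exactly four players; teams are never broken up. -/
  four_players : ∀ g ∈ games, ∑ p ∈ g.members, p.size = 4
  /-- The players of a game have arrived when it starts. -/
  present : ∀ g ∈ games, ∀ p ∈ g.members, arrival a₁ a₂ p ≤ g.start
  /-- Nobody plays twice: different games have disjoint sets of players. -/
  disjoint : games.PairwiseDisjoint Game.members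
  /-- Four or more players are never left waiting. -/
  prompt : ∀ t, queueLength a₁ a₂ games t < 4

/-- The waiting time of (each player of) a party. -/
def waitingTime (a₁ a₂ : ℝ≥0 → ℕ) (games : Set Game) (p : Party) : ℝ≥0∞ :=
  departure games p - arrival a₁ a₂ p

open Classical in
/-- The sum of the (full) waiting times of all players who arrive in `[0, t]`; each of the two
players of a team counts. -/
def totalWaitingTime (a₁ a₂ : ℝ≥0 → ℕ) (games : Set Game) (t : ℝ≥0) : ℝ≥0∞ :=
  ∑' p : Party,
    if arrival a₁ a₂ p ≤ t then (p.size : ℝ≥0∞) * waitingTime a₁ a₂ games p else 0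

/-- The number of players who arrive in `[0, t]`. -/
def playersArrived (a₁ a₂ : ℝ≥0 → ℕ) (t : ℝ≥0) : ℝ≥0∞ :=
  ((a₁ t + 2 * a₂ t : ℕ) : ℝ≥0∞)

end

end TwoVTwo

namespace TwoVTwo

open scoped ComplexConjugate

/-! Let N(t) = A₁(t) + 2A₂(t) be the number of players arrived by time t. Players leave in groups of
exactly four and fewer than four are ever left, so the queue length is N(t) mod 4 whatever the
mechanism (`queueLength_eq_mod`). Exchanging sum and integral, the waiting accumulated up to t is
the integral of N mod 4 over (0, t]. The full waiting time of the players arrived by t exceeds this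
only by what they wait after t, and that ends at the latest when the queue is next empty.

The time average of N mod 4 is 3/2, the mean of 0, 1, 2, 3. By Fourier expansion on ℤ/4 it suffices
that the time averages of z^N vanish for z = -1 and z = i. The correlations of z^N decay
exponentially, at a rate supplied by the individual arrivals, so a second-moment argument applies
(`ae_tendsto_average_zero`). The same expansion shows that the queue is empty a quarter of the time,
so almost surely the next empty time after t is at most (1 + ε)t for large t. Dividing by N(t)/t →
λ₁ + 2λ₂ gives the almost sure limit.

In expectation, the accumulated part converges by dominated convergence. The overshoot has bounded
mean, because at successive integer steps the queue stays nonempty with geometrically small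
probability (`exists_measure_forall_not_dvd_le`). -/

/-- A counting path: monotone and right-continuous. -/
structure IsCountingPath (a : ℝ≥0 → ℕ) : Prop where
  mono : Monotone a
  rightCont : ∀ t, ContinuousWithinAt a (Set.Ici t) t

/-! ### Jump times, arrivals and departures -/

/-- An integer-valued right-continuous path is constant just after `t`, so a jump not made by time
`t` is bounded away from `t`; hence the infimum defining `jumpTime` cannot equal `t` without being
attained. -/
theorem jumpTime_le_iff {a : ℝ≥0 → ℕ} (ha : IsCountingPath a) (k : ℕ) (t : ℝ≥0) :
    jumpTime a k ≤ t ↔ k < a t := by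
  constructor
  · intro h
    by_contra hk
    push Not at hk
    have h1 : ∀ᶠ s in 𝓝[≥] t, a s = a t :=
      (ha.rightCont t).eventually (eventually_of_mem
        (by rw [nhds_discrete]; exact Set.mem_singleton (a t)) fun x hx => hx)
    obtain ⟨u, hu, hu'⟩ := (mem_nhdsGE_iff_exists_Ico_subset).1 h1
    have : (u : ℝ≥0∞) ≤ jumpTime a k := by
      refine le_iInf₂ fun s hs => ?_
      rw [ENNReal.coe_le_coe]
      by_contra hsu
      push Not at hsu
      rcases le_total t s with hts | hts
      · have := hu' ⟨hts, hsu⟩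
        simp only [Set.mem_ofPred_eq] at this
        omega
      · have := ha.mono hts
        omega
    exact absurd (this.trans h) (by rw [ENNReal.coe_le_coe]; exact not_le.2 hu)
  · intro h
    exact iInf₂_le t h

/-- The parties that arrive up to time `t`. -/
def arrivedBy (a₁ a₂ : ℝ≥0 → ℕ) (t : ℝ≥0) : Finset Party :=
  (Finset.range (a₁ t)).disjSum (Finset.range (a₂ t))

theorem mem_arrivedBy {a₁ a₂ : ℝ≥0 → ℕ} (h₁ : IsCountingPath a₁) (h₂ : IsCountingPath a₂)
    {t : ℝ≥0} {p : Party} : p ∈ arrivedBy a₁ a₂ t ↔ arrival a₁ a₂ p ≤ t := by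
  rcases p with k | k
  · simp [arrivedBy, arrival, jumpTime_le_iff h₁]
  · simp [arrivedBy, arrival, jumpTime_le_iff h₂]

theorem sum_size_arrivedBy (a₁ a₂ : ℝ≥0 → ℕ) (t : ℝ≥0) :
    ∑ p ∈ arrivedBy a₁ a₂ t, p.size = a₁ t + 2 * a₂ t := by
  simp [arrivedBy, Finset.sum_disjSum, Party.size, mul_comm]

theorem departure_eq_start {games : Set Game} (hd : games.PairwiseDisjoint Game.members)
    {g : Game} (hg : g ∈ games) {p : Party} (hp : p ∈ g.members) :
    departure games p = g.start := by
  refine le_antisymm (iInf₂_le_of_le g hg (iInf_le _ hp)) ?_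
  refine le_iInf₂ fun g' hg' => le_iInf fun hp' => ?_
  have : g = g' := by
    by_contra hne
    exact Finset.disjoint_left.1 (hd hg hg' hne) hp hp'
  rw [this]

theorem departure_le_iff {games : Set Game} (hd : games.PairwiseDisjoint Game.members)
    {p : Party} {t : ℝ≥0} :
    departure games p ≤ t ↔ ∃ g ∈ games, p ∈ g.members ∧ g.start ≤ t := by
  constructor
  · intro h
    have hlt : departure games p < ⊤ := h.trans_lt ENNReal.coe_lt_top
    simp only [departure, iInf_lt_iff] at hlt
    obtain ⟨g, hg, hp, -⟩ := hlt
    rw [departure_eq_start hd hg hp] at h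
    exact ⟨g, hg, hp, by exact_mod_cast h⟩
  · rintro ⟨g, hg, hp, h⟩
    rw [departure_eq_start hd hg hp]
    exact_mod_cast h

/-! ### Pathwise comparison of waiting times with the queue integral -/

section Paths

variable {a₁ a₂ : ℝ≥0 → ℕ} {games : Set Game}

open Classical in
-- The departed parties are the disjoint union of the games started by time `t`, each with four
-- players.
theorem exists_sum_size_departed (h₁ : IsCountingPath a₁) (h₂ : IsCountingPath a₂)
    (hM : IsMatchmaking a₁ a₂ games) (t : ℝ≥0) :
    ∃ m : ℕ, ∑ p ∈ (arrivedBy a₁ a₂ t).filter (fun p => departure games p ≤ t), p.size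
      = 4 * m := by
  set G : Set Game := {g | g ∈ games ∧ g.start ≤ t} with hG
  have hne : ∀ g ∈ games, ∃ p, p ∈ g.members := by
    intro g hg
    by_contra hcon
    push Not at hcon
    have h4 := hM.four_players g hg
    rw [Finset.eq_empty_of_forall_notMem hcon] at h4
    simp at h4
  have hsub : ∀ g ∈ G, g.members ⊆ arrivedBy a₁ a₂ t := by
    intro g hg p hp
    rw [mem_arrivedBy h₁ h₂]
    exact (hM.present g hg.1 p hp).trans (by exact_mod_cast hg.2)
  -- Games are nonempty and pairwise disjoint, hence determined by their members, and those form
  -- subsets of a finite set.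
  have hfin : G.Finite := by
    refine Set.Finite.of_finite_image (f := Game.members)
      ((arrivedBy a₁ a₂ t).powerset.finite_toSet.subset ?_) ?_
    · rintro _ ⟨g, hg, rfl⟩
      simpa using hsub g hg
    · intro g hg g' hg' heq
      by_contra hcon
      obtain ⟨p, hp⟩ := hne g hg.1
      exact Finset.disjoint_left.1 (hM.disjoint hg.1 hg'.1 hcon) hp
        (heq ▸ hp)
  have hU : (arrivedBy a₁ a₂ t).filter (fun p => departure games p ≤ t)
      = hfin.toFinset.biUnion Game.members := by
    ext p
    simp only [Finset.mem_filter, departure_le_iff hM.disjoint, Finset.mem_biUnion,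
      Set.Finite.mem_toFinset]
    constructor
    · rintro ⟨-, g, hg, hp, hgt⟩
      exact ⟨g, ⟨hg, hgt⟩, hp⟩
    · rintro ⟨g, hg, hp⟩
      exact ⟨hsub g hg hp, g, hg.1, hp, hg.2⟩
  refine ⟨hfin.toFinset.card, ?_⟩
  rw [hU, Finset.sum_biUnion, Finset.sum_congr rfl
    (fun g hg => hM.four_players g (by simpa using (hfin.mem_toFinset.1 hg).1))]
  · simp [mul_comm]
  · intro g hg g' hg' hne'
    exact hM.disjoint (hfin.mem_toFinset.1 hg).1 (hfin.mem_toFinset.1 hg').1 hne'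

open Classical in
theorem queueLength_eq_sum (h₁ : IsCountingPath a₁) (h₂ : IsCountingPath a₂) (t : ℝ≥0) :
    queueLength a₁ a₂ games t =
      ((∑ p ∈ (arrivedBy a₁ a₂ t).filter (fun p => ¬ departure games p ≤ t), p.size : ℕ) :
        ℝ≥0∞) := by
  rw [queueLength, tsum_eq_sum (s := arrivedBy a₁ a₂ t), Nat.cast_sum, Finset.sum_filter]
  · refine Finset.sum_congr rfl fun p hp => ?_
    rw [mem_arrivedBy h₁ h₂] at hp
    simp [hp]
  · intro p hp
    rw [mem_arrivedBy h₁ h₂] at hp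
    simp [hp]

/-- Arrivals minus a multiple of four, and less than four: this is where the dependence on the
mechanism disappears. -/
theorem queueLength_eq_mod (h₁ : IsCountingPath a₁) (h₂ : IsCountingPath a₂)
    (hM : IsMatchmaking a₁ a₂ games) (t : ℝ≥0) :
    queueLength a₁ a₂ games t = (((a₁ t + 2 * a₂ t) % 4 : ℕ) : ℝ≥0∞) := by
  classical
  have hq := hM.prompt t
  rw [queueLength_eq_sum h₁ h₂] at hq ⊢
  obtain ⟨m, hm⟩ := exists_sum_size_departed h₁ h₂ hM t
  have hs := Finset.sum_filter_add_sum_filter_not (arrivedBy a₁ a₂ t)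
    (fun p => departure games p ≤ t) Party.size
  rw [sum_size_arrivedBy] at hs
  have hq' : ∑ p ∈ (arrivedBy a₁ a₂ t).filter (fun p => ¬ departure games p ≤ t), p.size < 4 := by
    exact_mod_cast hq
  congr 1
  omega

/-- The total waiting time that the players spend up to time `t`, as an integral of the queue
length. -/
noncomputable def queueIntegral (a₁ a₂ : ℝ≥0 → ℕ) (t : ℝ) : ℝ≥0∞ :=
  ∫⁻ s in Set.Ioc 0 t, (((a₁ s.toNNReal + 2 * a₂ s.toNNReal) % 4 : ℕ) : ℝ≥0∞)

theorem volume_between_le (a b : ℝ≥0∞) (t : ℝ) :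
    volume {s : ℝ | s ∈ Set.Ioc 0 t ∧ a ≤ ENNReal.ofReal s ∧ ENNReal.ofReal s < b} ≤ b - a := by
  rcases eq_or_ne a ⊤ with rfl | ha
  · simp [top_le_iff]
  rcases eq_or_ne b ⊤ with rfl | hb
  · simp [ENNReal.top_sub ha]
  refine (measure_mono (t := Set.Ico a.toReal b.toReal) ?_).trans ?_
  · rintro s ⟨⟨hs0, -⟩, has, hsb⟩
    exact ⟨(ENNReal.le_ofReal_iff_toReal_le ha hs0.le).1 has,
      (ENNReal.ofReal_lt_iff_lt_toReal hs0.le hb).1 hsb⟩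
  · rw [Real.volume_Ico, ENNReal.ofReal_sub _ ENNReal.toReal_nonneg, ENNReal.ofReal_toReal ha,
      ENNReal.ofReal_toReal hb]

theorem le_volume_between (a b : ℝ≥0∞) (t : ℝ≥0) (hb : b ≤ t) :
    b - a ≤
      volume {s : ℝ | s ∈ Set.Ioc 0 (t : ℝ) ∧ a ≤ ENNReal.ofReal s ∧ ENNReal.ofReal s < b} := by
  have hb' : b ≠ ⊤ := (hb.trans_lt ENNReal.coe_lt_top).ne
  rcases eq_or_ne a ⊤ with rfl | ha
  · simp
  have hbt : b.toReal ≤ t := ENNReal.toReal_le_coe_of_le_coe hb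
  refine le_trans ?_ (measure_mono (s := Set.Ioo a.toReal b.toReal) ?_)
  · rw [Real.volume_Ioo, ENNReal.ofReal_sub _ ENNReal.toReal_nonneg, ENNReal.ofReal_toReal ha,
      ENNReal.ofReal_toReal hb']
  · rintro s ⟨has, hsb⟩
    have hs0 : 0 < s := ENNReal.toReal_nonneg.trans_lt has
    exact ⟨⟨hs0, hsb.le.trans hbt⟩, (ENNReal.le_ofReal_iff_toReal_le ha hs0.le).2 has.le,
      (ENNReal.ofReal_lt_iff_lt_toReal hs0.le hb').2 hsb⟩

theorem measurableSet_between (a b : ℝ≥0∞) (t : ℝ) :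
    MeasurableSet {s : ℝ | s ∈ Set.Ioc 0 t ∧ a ≤ ENNReal.ofReal s ∧ ENNReal.ofReal s < b} := by
  refine measurableSet_Ioc.inter ((measurableSet_le measurable_const ENNReal.measurable_ofReal).inter
    (measurableSet_lt ENNReal.measurable_ofReal measurable_const))

/-- Tonelli: each party contributes its size times the time it spends in the queue during (0, t]. -/
theorem queueIntegral_eq_tsum (h₁ : IsCountingPath a₁) (h₂ : IsCountingPath a₂)
    (hM : IsMatchmaking a₁ a₂ games) (t : ℝ) :
    queueIntegral a₁ a₂ t = ∑' p : Party, (p.size : ℝ≥0∞) *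
      volume {s : ℝ | s ∈ Set.Ioc 0 t ∧ arrival a₁ a₂ p ≤ ENNReal.ofReal s ∧
        ENNReal.ofReal s < departure games p} := by
  classical
  have h : ∀ s : ℝ, (Set.Ioc 0 t).indicator
      (fun s : ℝ => (((a₁ s.toNNReal + 2 * a₂ s.toNNReal) % 4 : ℕ) : ℝ≥0∞)) s
      = ∑' p : Party, {s : ℝ | s ∈ Set.Ioc 0 t ∧ arrival a₁ a₂ p ≤ ENNReal.ofReal s ∧
        ENNReal.ofReal s < departure games p}.indicator (fun _ => (p.size : ℝ≥0∞)) s := by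
    intro s
    by_cases hs : s ∈ Set.Ioc 0 t
    · rw [Set.indicator_of_mem hs, ← queueLength_eq_mod h₁ h₂ hM, queueLength]
      refine tsum_congr fun p => ?_
      simp only [Set.indicator_apply, Set.mem_ofPred_eq, hs, true_and]
      rfl
    · rw [Set.indicator_of_notMem hs, eq_comm, ENNReal.tsum_eq_zero]
      exact fun p => Set.indicator_of_notMem (fun h => hs h.1) _
  rw [queueIntegral, ← lintegral_indicator measurableSet_Ioc]
  simp_rw [h]
  rw [lintegral_tsum fun p =>
    (measurable_const.indicator (measurableSet_between _ _ _)).aemeasurable]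
  refine tsum_congr fun p => ?_
  rw [lintegral_indicator_const (measurableSet_between _ _ _)]

theorem queueIntegral_le_totalWaitingTime (h₁ : IsCountingPath a₁) (h₂ : IsCountingPath a₂)
    (hM : IsMatchmaking a₁ a₂ games) (t : ℝ≥0) :
    queueIntegral a₁ a₂ t ≤ totalWaitingTime a₁ a₂ games t := by
  rw [queueIntegral_eq_tsum h₁ h₂ hM, totalWaitingTime]
  refine ENNReal.tsum_le_tsum fun p => ?_
  split_ifs with hp
  · gcongr
    exact volume_between_le _ _ _
  · rw [show {s : ℝ | s ∈ Set.Ioc 0 (t : ℝ) ∧ arrival a₁ a₂ p ≤ ENNReal.ofReal s ∧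
        ENNReal.ofReal s < departure games p} = ∅ from ?_]
    · simp
    · ext s
      simp only [Set.mem_ofPred_eq, Set.mem_empty_iff_false, iff_false]
      rintro ⟨⟨-, hst⟩, has, -⟩
      exact hp (has.trans (ENNReal.ofReal_le_coe.2 hst))

/-- The queue is empty at `T`, so every party arrived by `t` has left by `T` and its whole wait lies
in [0, T]. -/
theorem totalWaitingTime_le_queueIntegral (h₁ : IsCountingPath a₁) (h₂ : IsCountingPath a₂)
    (hM : IsMatchmaking a₁ a₂ games) {t T : ℝ≥0} (htT : t ≤ T) (hT : 4 ∣ a₁ T + 2 * a₂ T) :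
    totalWaitingTime a₁ a₂ games t ≤ queueIntegral a₁ a₂ T := by
  rw [queueIntegral_eq_tsum h₁ h₂ hM, totalWaitingTime]
  refine ENNReal.tsum_le_tsum fun p => ?_
  split_ifs with hp
  · have hdep : departure games p ≤ T := by
      have h0 := queueLength_eq_mod h₁ h₂ hM T
      rw [Nat.mod_eq_zero_of_dvd hT, queueLength, Nat.cast_zero, ENNReal.tsum_eq_zero] at h0
      have := h0 p
      by_contra hcon
      rw [if_pos ⟨hp.trans (by exact_mod_cast htT), not_le.1 hcon⟩] at this
      rcases p with k | k <;> simp [Party.size] at this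
    gcongr
    exact le_volume_between _ _ _ hdep
  · exact zero_le

theorem queueIntegral_le_add (t T : ℝ) (h0 : 0 ≤ t) :
    queueIntegral a₁ a₂ T ≤ queueIntegral a₁ a₂ t + 3 * ENNReal.ofReal (T - t) := by
  rcases le_total t T with h | h
  · rw [queueIntegral, ← Set.Ioc_union_Ioc_eq_Ioc h0 h]
    refine (lintegral_union_le _ _ _).trans ?_
    gcongr
    · rfl
    · refine (lintegral_mono (g := fun _ => 3) fun s => ?_).trans ?_
      · have : (a₁ s.toNNReal + 2 * a₂ s.toNNReal) % 4 ≤ 3 := by omega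
        exact (Nat.cast_le.2 this).trans (by norm_num)
      · simp
  · refine le_add_right (lintegral_mono_set (Set.Ioc_subset_Ioc_right h))

end Paths

/-! ### Generating function and mean of the Poisson law -/

section Moments

theorem integral_pow_poissonMeasure (r : ℝ≥0) (z : ℂ) :
    ∫ n, z ^ n ∂(poissonMeasure r) = Complex.exp (r * (z - 1)) := by
  rw [integral_poissonMeasure]
  have h := (NormedSpace.expSeries_div_hasSum_exp ((r : ℂ) * z)).mul_left (Complex.exp (-(r : ℂ)))
  rw [← Complex.exp_eq_exp_ℂ, ← Complex.exp_add] at h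
  rw [show (r : ℂ) * (z - 1) = -(r : ℂ) + r * z by ring, ← h.tsum_eq]
  refine tsum_congr fun n => ?_
  rw [Complex.real_smul]
  push_cast
  rw [mul_pow]
  ring

theorem lintegral_natCast_poissonMeasure (r : ℝ≥0) :
    ∫⁻ n, (n : ℝ≥0∞) ∂(poissonMeasure r) = r := by
  have h : HasSum (fun n : ℕ => Real.exp (-r) * (r : ℝ) ^ n / n.factorial * n) r := by
    -- The term at 0 vanishes, and the term at n + 1 is r times the Poisson mass at n.
    rw [← hasSum_nat_add_iff' 1]
    have h1 := (hasSum_one_poissonMeasure r).mul_left (r : ℝ)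
    have h2 : (fun n : ℕ => Real.exp (-r) * (r : ℝ) ^ (n + 1) / (n + 1).factorial * (n + 1 : ℕ))
        = fun n : ℕ => (r : ℝ) * (Real.exp (-r) * (r : ℝ) ^ n / n.factorial) := by
      ext n
      rw [Nat.factorial_succ]
      push_cast
      field_simp
      exact pow_succ' _ _
    rw [h2]
    simpa using h1
  rw [poissonMeasure, lintegral_sum_measure]
  simp_rw [lintegral_smul_measure, lintegral_dirac, smul_eq_mul]
  have h3 := ENNReal.ofReal_tsum_of_nonneg (fun n => by positivity) h.summable
  rw [h.tsum_eq, ENNReal.ofReal_coe_nnreal] at h3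
  rw [h3]
  refine tsum_congr fun n => ?_
  rw [ENNReal.ofReal_mul (by positivity), ENNReal.ofReal_natCast]

end Moments

/-! ### Independent increments and a geometric bound modulo 4 -/

section Independence

variable {Ω : Type*} [MeasurableSpace Ω] {P : Measure Ω} [IsProbabilityMeasure P]

/-- The joint law of the pairs is a rearrangement of the product of the two product laws. -/
theorem iIndepFun_prodMk {ι α β : Type*} [Fintype ι] [MeasurableSpace α] [MeasurableSpace β]
    {X : ι → Ω → α} {Y : ι → Ω → β} (hX : ∀ i, Measurable (X i)) (hY : ∀ i, Measurable (Y i))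
    (hiX : iIndepFun X P) (hiY : iIndepFun Y P)
    (hXY : IndepFun (fun ω i => X i ω) (fun ω i => Y i ω) P) :
    iIndepFun (fun i ω => (X i ω, Y i ω)) P := by
  rw [iIndepFun_iff_map_fun_eq_pi_map fun i => ((hX i).prodMk (hY i)).aemeasurable]
  have hpair : ∀ i, P.map (fun ω => (X i ω, Y i ω)) = (P.map (X i)).prod (P.map (Y i)) := by
    intro i
    exact (hXY.comp (measurable_pi_apply i) (measurable_pi_apply i)).map_prod_eq_prod_map_map
      (hX i).aemeasurable (hY i).aemeasurable
  simp_rw [hpair]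
  have : ∀ i, IsProbabilityMeasure (P.map (X i)) := fun i =>
    Measure.isProbabilityMeasure_map (hX i).aemeasurable
  have : ∀ i, IsProbabilityMeasure (P.map (Y i)) := fun i =>
    Measure.isProbabilityMeasure_map (hY i).aemeasurable
  have hmp := (measurePreserving_arrowProdEquivProdArrow α β ι (fun i => P.map (X i))
    (fun i => P.map (Y i))).symm
  rw [← hmp.map_eq, ← hiX.map_fun_eq_pi_map fun i => (hX i).aemeasurable,
    ← hiY.map_fun_eq_pi_map fun i => (hY i).aemeasurable,
    ← hXY.map_prod_eq_prod_map_map (measurable_pi_lambda _ hX).aemeasurable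
      (measurable_pi_lambda _ hY).aemeasurable,
    Measure.map_map (MeasurableEquiv.measurable _)
      ((measurable_pi_lambda _ hX).prodMk (measurable_pi_lambda _ hY))]
  rfl

/-- If the sum so far is r mod 4, the next increment must avoid -r, which has probability at most
`q` independently of the past. Nothing is assumed on the law of `D 0`, hence the exponent `n` for `n
+ 1` partial sums. -/
theorem measure_forall_not_dvd_le {D : ℕ → Ω → ℕ} (hD : ∀ n, Measurable (D n))
    (hi : iIndepFun D P) {q : ℝ≥0∞}
    (hq : ∀ n, ∀ r < 4, P {ω | D (n + 1) ω % 4 ≠ r} ≤ q) (n : ℕ) :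
    P {ω | ∀ k ≤ n, ¬ 4 ∣ ∑ i ∈ Finset.range (k + 1), D i ω} ≤ q ^ n := by
  induction n with
  | zero => simpa using prob_le_one
  | succ n ih =>
    set E : ℕ → Set Ω := fun m => {ω | ∀ k ≤ m, ¬ 4 ∣ ∑ i ∈ Finset.range (k + 1), D i ω} with hE
    -- The event of step `n` with prescribed residue, as a set of values of the first `n + 1`
    -- increments, so that independence of the next one applies.
    let F : ℕ → Set (Finset.range (n + 1) → ℕ) := fun r =>
      {x | (∀ k ≤ n, ¬ 4 ∣ ∑ i : Finset.range (n + 1), if i.1 ≤ k then x i else 0) ∧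
        (∑ i, x i) % 4 = r}
    have hFsum : ∀ (k : ℕ) (ω : Ω), k ≤ n →
        (∑ i : Finset.range (n + 1), if i.1 ≤ k then D i ω else 0)
          = ∑ i ∈ Finset.range (k + 1), D i ω := by
      intro k ω hk
      rw [Finset.sum_coe_sort (Finset.range (n + 1)) (fun i => if i ≤ k then D i ω else 0),
        ← Finset.sum_filter]
      congr 1
      ext i
      simp only [Finset.mem_filter, Finset.mem_range]
      omega
    have hFpre : ∀ r, (fun ω (i : Finset.range (n + 1)) => D i ω) ⁻¹' (F r)
        = E n ∩ {ω | (∑ i ∈ Finset.range (n + 1), D i ω) % 4 = r} := by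
      intro r
      ext ω
      simp only [F, hE, Set.mem_preimage, Set.mem_ofPred_eq, Set.mem_inter_iff]
      rw [Finset.sum_coe_sort (Finset.range (n + 1)) (fun i => D i ω)]
      refine and_congr_left fun _ => forall₂_congr fun k hk => ?_
      rw [hFsum k ω hk]
    have hind : IndepFun (fun ω (i : Finset.range (n + 1)) => D i ω) (D (n + 1)) P := by
      have := hi.indepFun_finset (Finset.range (n + 1)) {n + 1} (by simp) hD
      exact this.comp measurable_id
        (measurable_pi_apply (⟨n + 1, by simp⟩ : ({n + 1} : Finset ℕ)))
    have hsub : E (n + 1) ⊆ ⋃ r ∈ Finset.range 4,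
        ((fun ω (i : Finset.range (n + 1)) => D i ω) ⁻¹' (F r)) ∩
          (D (n + 1) ⁻¹' {d | d % 4 ≠ (4 - r) % 4}) := by
      intro ω hω
      simp only [Set.mem_iUnion, hFpre]
      refine ⟨(∑ i ∈ Finset.range (n + 1), D i ω) % 4, Finset.mem_range.2 (Nat.mod_lt _ (by norm_num)),
        ⟨fun k hk => hω k (hk.trans n.le_succ), rfl⟩, ?_⟩
      have := hω (n + 1) le_rfl
      rw [Finset.sum_range_succ] at this
      simp only [Set.mem_preimage, Set.mem_ofPred_eq]
      omega
    have hmE : ∀ r, MeasurableSet ((fun ω (i : Finset.range (n + 1)) => D i ω) ⁻¹' (F r)) :=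
      fun r => (measurable_pi_lambda _ fun i : Finset.range (n + 1) => hD i) (Set.to_countable _).measurableSet
    calc P (E (n + 1)) ≤ ∑ r ∈ Finset.range 4,
          P (((fun ω (i : Finset.range (n + 1)) => D i ω) ⁻¹' (F r)) ∩
            (D (n + 1) ⁻¹' {d | d % 4 ≠ (4 - r) % 4})) :=
          (measure_mono hsub).trans (measure_biUnion_finset_le _ _)
      _ ≤ ∑ r ∈ Finset.range 4, P ((fun ω (i : Finset.range (n + 1)) => D i ω) ⁻¹' (F r)) * q := by
          refine Finset.sum_le_sum fun r _ => ?_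
          rw [hind.measure_inter_preimage_eq_mul _ _ (Set.to_countable _).measurableSet
            (Set.to_countable _).measurableSet]
          gcongr
          exact hq n _ (Nat.mod_lt _ (by norm_num))
      _ = P (⋃ r ∈ Finset.range 4, (fun ω (i : Finset.range (n + 1)) => D i ω) ⁻¹' (F r)) * q := by
          rw [← Finset.sum_mul, measure_biUnion_finset _ fun r _ => hmE r]
          intro r _ r' _ hrr'
          refine Set.disjoint_left.2 fun ω h h' => hrr' ?_
          exact h.2.symm.trans h'.2
      _ ≤ P (E n) * q := by
          gcongr
          refine Set.iUnion₂_subset fun r _ => ?_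
          rw [hFpre]
          exact Set.inter_subset_left
      _ ≤ q ^ (n + 1) := by
          rw [pow_succ]
          gcongr

end Independence

/-! ### Second moments and vanishing time averages -/

theorem integrable_exp_neg_mul_abs {c : ℝ} (hc : 0 < c) :
    Integrable fun x : ℝ => Real.exp (-c * |x|) := by
  rw [← integrableOn_univ, ← Set.Iic_union_Ioi (a := (0 : ℝ))]
  refine IntegrableOn.union ?_ ?_
  · refine (integrableOn_exp_mul_Iic hc 0).congr_fun (fun x hx => ?_) measurableSet_Iic
    simp only [abs_of_nonpos (Set.mem_Iic.1 hx)]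
    ring_nf
  · refine (exp_neg_integrableOn_Ioi 0 hc).congr_fun (fun x hx => ?_) measurableSet_Ioi
    simp only [abs_of_pos (Set.mem_Ioi.1 hx)]

section SecondMoment

variable {Ω : Type*} [MeasurableSpace Ω] {P : Measure Ω}

theorem ae_tendsto_zero_of_tsum_sq {E : Type*} [NormedAddCommGroup E] {Y : ℕ → Ω → E}
    (hY : ∀ n, AEStronglyMeasurable (Y n) P)
    (hsum : ∑' n, ∫⁻ ω, ‖Y n ω‖ₑ ^ 2 ∂P ≠ ⊤) : ∀ᵐ ω ∂P, Tendsto (fun n => Y n ω) atTop (𝓝 0) := by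
  have hm : ∀ n, AEMeasurable (fun ω => ‖Y n ω‖ₑ ^ 2) P := fun n => (hY n).enorm.pow_const 2
  rw [← lintegral_tsum hm] at hsum
  filter_upwards [ae_lt_top' (AEMeasurable.tsum hm) hsum] with ω hω
  have h := ENNReal.tendsto_atTop_zero_of_tsum_ne_top hω.ne
  have h2 := h.ennrpow_const (1 / 2 : ℝ)
  rw [ENNReal.zero_rpow_of_pos (by norm_num)] at h2
  rw [tendsto_iff_enorm_sub_tendsto_zero]
  refine h2.congr fun n => ?_
  rw [sub_zero, ← ENNReal.rpow_natCast, ← ENNReal.rpow_mul]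
  norm_num

variable [IsProbabilityMeasure P]

/-- Fubini turns the second moment into a double integral of correlations; for each s the integral
over u is at most that of exp(-c|x|) over the line. -/
theorem lintegral_enorm_sq_setIntegral_le {X : ℝ → Ω → ℂ} (hX : Measurable (Function.uncurry X))
    (hb : ∀ s ω, ‖X s ω‖ ≤ 1) {c : ℝ} (hc : 0 < c)
    (hcorr : ∀ s u, 0 ≤ s → 0 ≤ u →
      ‖∫ ω, X s ω * conj (X u ω) ∂P‖ ≤ Real.exp (-c * |s - u|)) {t : ℝ} (ht : 0 ≤ t) :
    ∫⁻ ω, ‖∫ s in Set.Ioc 0 t, X s ω‖ₑ ^ 2 ∂P ≤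
      ENNReal.ofReal ((∫ x : ℝ, Real.exp (-c * |x|)) * t) := by
  set μ : Measure ℝ := volume.restrict (Set.Ioc 0 t) with hμ
  set C : ℝ := ∫ x : ℝ, Real.exp (-c * |x|) with hC
  have hG : Measurable fun p : Ω × (ℝ × ℝ) => X p.2.1 p.1 * conj (X p.2.2 p.1) := by
    have h1 : Measurable fun p : Ω × (ℝ × ℝ) => X p.2.1 p.1 :=
      hX.comp (measurable_snd.fst.prodMk measurable_fst)
    have h2 : Measurable fun p : Ω × (ℝ × ℝ) => X p.2.2 p.1 :=
      hX.comp (measurable_snd.snd.prodMk measurable_fst)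
    exact h1.mul (Complex.continuous_conj.measurable.comp h2)
  have hGb : ∀ ω s u, ‖X s ω * conj (X u ω)‖ ≤ 1 := by
    intro ω s u
    rw [norm_mul, RCLike.norm_conj]
    exact mul_le_one₀ (hb _ _) (norm_nonneg _) (hb _ _)
  have hGint : Integrable (Function.uncurry fun (ω : Ω) (p : ℝ × ℝ) => X p.1 ω * conj (X p.2 ω))
      (P.prod (μ.prod μ)) :=
    Integrable.of_bound hG.aestronglyMeasurable 1 (ae_of_all _ fun p => hGb _ _ _)
  have hsq : ∀ ω, ((‖∫ s, X s ω ∂μ‖ ^ 2 : ℝ) : ℂ)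
      = ∫ p, X p.1 ω * conj (X p.2 ω) ∂(μ.prod μ) := by
    intro ω
    rw [integral_prod_mul (fun s => X s ω) (fun s => conj (X s ω)), integral_conj, Complex.mul_conj,
      Complex.normSq_eq_norm_sq]
  have hE : ∫ ω, ‖∫ s, X s ω ∂μ‖ ^ 2 ∂P ≤ C * t := by
    have h1 : ((∫ ω, ‖∫ s, X s ω ∂μ‖ ^ 2 ∂P : ℝ) : ℂ)
        = ∫ p, ∫ ω, X p.1 ω * conj (X p.2 ω) ∂P ∂(μ.prod μ) := by
      rw [← integral_complex_ofReal, ← integral_integral_swap hGint]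
      exact integral_congr_ae (ae_of_all _ hsq)
    have hint : Integrable (fun p : ℝ × ℝ => Real.exp (-c * |p.1 - p.2|)) (μ.prod μ) := by
      refine Integrable.of_bound (Measurable.aestronglyMeasurable (by fun_prop)) 1
        (ae_of_all _ fun p => ?_)
      rw [Real.norm_eq_abs, Real.abs_exp, Real.exp_le_one_iff]
      have := abs_nonneg (p.1 - p.2)
      nlinarith
    have hnn : 0 ≤ ∫ ω, ‖∫ s, X s ω ∂μ‖ ^ 2 ∂P := integral_nonneg fun ω => by positivity
    calc ∫ ω, ‖∫ s, X s ω ∂μ‖ ^ 2 ∂P = ‖((∫ ω, ‖∫ s, X s ω ∂μ‖ ^ 2 ∂P : ℝ) : ℂ)‖ := by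
          rw [Complex.norm_real, Real.norm_of_nonneg hnn]
      _ ≤ ∫ p, Real.exp (-c * |p.1 - p.2|) ∂(μ.prod μ) := by
          rw [h1]
          refine norm_integral_le_of_norm_le hint ?_
          have hmem : ∀ᵐ p ∂(μ.prod μ), p ∈ Set.Ioc 0 t ×ˢ Set.Ioc 0 t := by
            rw [hμ, Measure.prod_restrict]
            exact ae_restrict_mem (measurableSet_Ioc.prod measurableSet_Ioc)
          filter_upwards [hmem] with p hp
          exact hcorr _ _ hp.1.1.le hp.2.1.le
      _ = ∫ s, ∫ u, Real.exp (-c * |s - u|) ∂μ ∂μ := integral_prod _ hint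
      _ ≤ ∫ _, C ∂μ := by
          refine integral_mono hint.integral_prod_left (integrable_const _) fun s => ?_
          have h2 := integral_sub_left_eq_self (fun x : ℝ => Real.exp (-c * |x|)) volume s
          rw [hC, ← h2]
          exact setIntegral_le_integral ((integrable_exp_neg_mul_abs hc).comp_sub_left s)
            (ae_of_all _ fun u => Real.exp_nonneg _)
      _ = C * t := by
          simp [hμ, ht, mul_comm]
  have hmeas : AEStronglyMeasurable (fun ω => ∫ s, X s ω ∂μ) P := by
    have : StronglyMeasurable (Function.uncurry fun ω s => X s ω) :=
      (hX.comp measurable_swap).stronglyMeasurable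
    exact this.integral_prod_right.aestronglyMeasurable
  have hle : ∀ ω, ‖∫ s, X s ω ∂μ‖ ≤ t := by
    intro ω
    have := norm_integral_le_of_norm_le_const (μ := μ) (f := fun s => X s ω) (C := 1)
      (ae_of_all _ fun s => hb s ω)
    simpa [hμ, ht] using this
  have hi2 : Integrable (fun ω => ‖∫ s, X s ω ∂μ‖ ^ 2) P := by
    refine Integrable.of_bound (hmeas.norm.pow 2) (t ^ 2) (ae_of_all _ fun ω => ?_)
    rw [Real.norm_of_nonneg (by positivity)]
    gcongr
    exact hle ω
  refine le_trans (le_of_eq ?_) (ENNReal.ofReal_le_ofReal hE)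
  rw [ofReal_integral_eq_lintegral_ofReal hi2 (ae_of_all _ fun ω => by positivity)]
  refine lintegral_congr fun ω => ?_
  rw [ENNReal.ofReal_pow (norm_nonneg _), ofReal_norm]

/-- Along t = n² the averages have second moment O(n⁻²), which is summable. Since the integrand is
bounded by 1, passing from n² to t < (n + 1)² costs only O(√t), negligible after division by t. -/
theorem ae_tendsto_average_zero {X : ℝ → Ω → ℂ} (hX : Measurable (Function.uncurry X))
    (hb : ∀ s ω, ‖X s ω‖ ≤ 1) {c : ℝ} (hc : 0 < c)
    (hcorr : ∀ s u, 0 ≤ s → 0 ≤ u →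
      ‖∫ ω, X s ω * conj (X u ω) ∂P‖ ≤ Real.exp (-c * |s - u|)) :
    ∀ᵐ ω ∂P, Tendsto (fun t : ℝ => (t : ℂ)⁻¹ * ∫ s in Set.Ioc 0 t, X s ω) atTop (𝓝 0) := by
  have hXω : ∀ ω, Measurable fun s => X s ω := fun ω =>
    hX.comp (measurable_id.prodMk measurable_const)
  have hsubseq : ∀ᵐ ω ∂P, Tendsto
      (fun n : ℕ => ((n : ℂ) ^ 2)⁻¹ * ∫ s in Set.Ioc 0 ((n : ℝ) ^ 2), X s ω) atTop (𝓝 0) := by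
    refine ae_tendsto_zero_of_tsum_sq (fun n => ?_) ?_
    · have : StronglyMeasurable (Function.uncurry fun ω s => X s ω) :=
        (hX.comp measurable_swap).stronglyMeasurable
      exact (this.integral_prod_right (ν := volume.restrict (Set.Ioc 0 ((n : ℝ) ^ 2)))).aestronglyMeasurable.const_mul _
    · set C : ℝ := ∫ x : ℝ, Real.exp (-c * |x|) with hC
      have hC0 : 0 ≤ C := integral_nonneg fun x => Real.exp_nonneg _
      have hbound : ∀ n : ℕ,
          ∫⁻ ω, ‖((n : ℂ) ^ 2)⁻¹ * ∫ s in Set.Ioc 0 ((n : ℝ) ^ 2), X s ω‖ₑ ^ 2 ∂P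
            ≤ ENNReal.ofReal (C * ((n : ℝ) ^ 2)⁻¹) := by
        intro n
        simp_rw [enorm_mul, mul_pow]
        rw [lintegral_const_mul' _ _ (by simp)]
        refine (mul_le_mul_right (lintegral_enorm_sq_setIntegral_le hX hb hc hcorr
          (by positivity : (0 : ℝ) ≤ (n : ℝ) ^ 2)) _).trans ?_
        rw [← ofReal_norm, ← ENNReal.ofReal_pow (norm_nonneg _),
          ← ENNReal.ofReal_mul (by positivity)]
        refine ENNReal.ofReal_le_ofReal (le_of_eq ?_)
        -- At n = 0 both sides are 0, since 0⁻¹ = 0.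
        rcases eq_or_ne n 0 with rfl | hn
        · simp
        · have : (n : ℝ) ≠ 0 := by exact_mod_cast hn
          rw [norm_inv, norm_pow, Complex.norm_natCast, ← hC]
          field_simp
      refine ((ENNReal.tsum_le_tsum hbound).trans_lt ?_).ne
      rw [← ENNReal.ofReal_tsum_of_nonneg (fun n => by positivity)]
      · exact ENNReal.ofReal_lt_top
      · exact (Real.summable_nat_pow_inv.2 (by norm_num)).mul_left C
  filter_upwards [hsubseq] with ω hω
  have hfloor : Tendsto (fun t : ℝ => ⌊Real.sqrt t⌋₊) atTop atTop :=
    tendsto_nat_floor_atTop.comp Real.tendsto_sqrt_atTop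
  have h1 := (hω.comp hfloor).norm
  rw [norm_zero] at h1
  have h2 : Tendsto (fun t : ℝ => 2 * (Real.sqrt t)⁻¹ + t⁻¹) atTop (𝓝 0) := by
    have := (Real.tendsto_sqrt_atTop.inv_tendsto_atTop.const_mul 2).add tendsto_inv_atTop_zero
    simpa using this
  have h3 := h1.add h2
  rw [add_zero] at h3
  refine squeeze_zero_norm' ?_ h3
  filter_upwards [eventually_ge_atTop (1 : ℝ)] with t ht
  have ht0 : 0 < t := by linarith
  set n := ⌊Real.sqrt t⌋₊ with hn
  have hn1 : (1 : ℝ) ≤ n := by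
    exact_mod_cast Nat.le_floor (by simpa using Real.one_le_sqrt.2 ht)
  have hnle : (n : ℝ) ≤ Real.sqrt t := Nat.floor_le (Real.sqrt_nonneg t)
  have hnlt : Real.sqrt t < n + 1 := Nat.lt_floor_add_one _
  have hsq : Real.sqrt t ^ 2 = t := Real.sq_sqrt ht0.le
  have hs1 : 1 ≤ Real.sqrt t := Real.one_le_sqrt.2 ht
  have hn2 : (n : ℝ) ^ 2 ≤ t := by nlinarith
  have hdiff : t - (n : ℝ) ^ 2 ≤ 2 * Real.sqrt t + 1 := by nlinarith
  have hint : ∀ a b : ℝ, IntegrableOn (fun s => X s ω) (Set.Ioc a b) := fun a b =>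
    Integrable.of_bound (hXω ω).aestronglyMeasurable 1 (ae_of_all _ fun s => hb s ω)
  rw [← Set.Ioc_union_Ioc_eq_Ioc (by positivity : (0 : ℝ) ≤ (n : ℝ) ^ 2) hn2,
    setIntegral_union (Set.Ioc_disjoint_Ioc_of_le le_rfl) measurableSet_Ioc (hint _ _) (hint _ _),
    mul_add]
  refine (norm_add_le _ _).trans (add_le_add ?_ ?_)
  · simp only [Function.comp_apply, ← hn, norm_mul]
    gcongr
    rw [norm_inv, norm_inv, norm_pow, Complex.norm_natCast, Complex.norm_real,
      Real.norm_of_nonneg ht0.le]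
    gcongr
  · have hle : ‖∫ s in Set.Ioc ((n : ℝ) ^ 2) t, X s ω‖ ≤ t - (n : ℝ) ^ 2 := by
      have := norm_integral_le_of_norm_le_const
        (μ := volume.restrict (Set.Ioc ((n : ℝ) ^ 2) t)) (f := fun s => X s ω) (C := 1)
        (ae_of_all _ fun s => hb s ω)
      simpa [hn2] using this
    rw [norm_mul, norm_inv, Complex.norm_real, Real.norm_of_nonneg ht0.le]
    calc t⁻¹ * ‖∫ s in Set.Ioc ((n : ℝ) ^ 2) t, X s ω‖ ≤ t⁻¹ * (2 * Real.sqrt t + 1) := by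
          gcongr
          exact hle.trans hdiff
      _ = 2 * (Real.sqrt t)⁻¹ + t⁻¹ := by
          field_simp
          linear_combination 2 * hsq

end SecondMoment

/-! ### Poisson processes: measurability, moments, law of large numbers -/

section Processes

variable {Ω : Type*} [MeasurableSpace Ω] {P : Measure Ω}

namespace IsPoissonProcess

variable {A : ℝ≥0 → Ω → ℕ} {r : ℝ≥0}

theorem isCountingPath (hA : IsPoissonProcess A r P) (ω : Ω) : IsCountingPath fun t => A t ω :=
  ⟨hA.mono ω, hA.rightCont ω⟩

theorem measurable_jumpTime (hA : IsPoissonProcess A r P) (k : ℕ) :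
    Measurable fun ω => jumpTime (fun t => A t ω) k := by
  refine measurable_of_Iic fun x => ?_
  induction x with
  | top => simp
  | coe x =>
    have : (fun ω => jumpTime (fun t => A t ω) k) ⁻¹' Set.Iic (x : ℝ≥0∞) = A x ⁻¹' Set.Ioi k := by
      ext ω
      exact jumpTime_le_iff (hA.isCountingPath ω) k x
    rw [this]
    exact hA.measurable x measurableSet_Ioi

/-- Joint measurability holds because the event `k < A t` is a comparison of `t` with a measurable
jump time. -/
theorem measurable_uncurry (hA : IsPoissonProcess A r P) :
    Measurable fun p : ℝ × Ω => A p.1.toNNReal p.2 := by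
  refine measurable_of_Ioi fun k => ?_
  have : (fun p : ℝ × Ω => A p.1.toNNReal p.2) ⁻¹' Set.Ioi k
      = {p | jumpTime (fun t => A t p.2) k ≤ ENNReal.ofReal p.1} := by
    ext p
    exact (jumpTime_le_iff (hA.isCountingPath p.2) k p.1.toNNReal).symm
  rw [this]
  exact measurableSet_le ((hA.measurable_jumpTime k).comp measurable_snd)
    (ENNReal.measurable_ofReal.comp measurable_fst)

theorem law_zero (hA : IsPoissonProcess A r P) (t : ℝ≥0) :
    HasLaw (A t) (poissonMeasure (r * t)) P := by
  have := hA.law 0 t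
  simpa [hA.zero] using this

theorem lintegral_eq (hA : IsPoissonProcess A r P) (t : ℝ≥0) :
    ∫⁻ ω, (A t ω : ℝ≥0∞) ∂P = r * t := by
  have := (hA.law_zero t).lintegral_comp (f := fun n : ℕ => (n : ℝ≥0∞))
    (measurable_of_countable _).aemeasurable
  rw [this, lintegral_natCast_poissonMeasure, ENNReal.coe_mul]

theorem integral_eq (hA : IsPoissonProcess A r P) (t : ℝ≥0) :
    ∫ ω, (A t ω : ℝ) ∂P = r * t := by
  rw [integral_eq_lintegral_of_nonneg_ae (ae_of_all _ fun ω => Nat.cast_nonneg _)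
    ((measurable_of_countable _).comp (hA.measurable t)).aestronglyMeasurable]
  simp [hA.lintegral_eq]

theorem integrable (hA : IsPoissonProcess A r P) (t : ℝ≥0) :
    Integrable (fun ω => (A t ω : ℝ)) P := by
  refine ⟨((measurable_of_countable _).comp (hA.measurable t)).aestronglyMeasurable, ?_⟩
  rw [HasFiniteIntegral]
  simp_rw [← ofReal_norm, Real.norm_natCast, ENNReal.ofReal_natCast]
  rw [hA.lintegral_eq, ← ENNReal.coe_mul]
  exact ENNReal.coe_lt_top

theorem integral_pow_sub (hA : IsPoissonProcess A r P) (s h : ℝ≥0) (z : ℂ) :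
    ∫ ω, z ^ (A (s + h) ω - A s ω) ∂P = Complex.exp (r * h * (z - 1)) := by
  have := (hA.law s h).integral_comp (f := fun n : ℕ => z ^ n)
    (measurable_of_countable _).aestronglyMeasurable
  simp only [Function.comp_def] at this
  rw [this, integral_pow_poissonMeasure]
  push_cast
  rfl

theorem sum_increments (hA : IsPoissonProcess A r P) {t : ℕ → ℝ≥0} (ht : Monotone t)
    (h0 : t 0 = 0) (n : ℕ) (ω : Ω) :
    ∑ i ∈ Finset.range n, (A (t (i + 1)) ω - A (t i) ω) = A (t n) ω := by
  induction n with
  | zero => simp [h0, hA.zero]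
  | succ n ih =>
    rw [Finset.sum_range_succ, ih]
    have := hA.mono ω (ht (Nat.le_add_right n 1))
    simp only at this
    omega

/-- Strong law for the i.i.d. unit increments. -/
theorem ae_tendsto_div_nat (hA : IsPoissonProcess A r P) :
    ∀ᵐ ω ∂P, Tendsto (fun n : ℕ => (A n ω : ℝ) / n) atTop (𝓝 r) := by
  have hmono : Monotone fun n : ℕ => (n : ℝ≥0) := Nat.mono_cast
  have hlaw : ∀ n : ℕ, HasLaw (fun ω => A ((n + 1 : ℕ) : ℝ≥0) ω - A n ω) (poissonMeasure (r * 1)) P := by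
    intro n
    simpa using hA.law n 1
  have hind := hA.indepIncrements.nat hmono
  have h := strong_law_ae_real (μ := P)
    (fun (n : ℕ) ω => ((A ((n + 1 : ℕ) : ℝ≥0) ω - A n ω : ℕ) : ℝ)) ?_ ?_ ?_
  · filter_upwards [h] with ω hω
    have hlim : ∫ ω, ((A ((0 + 1 : ℕ) : ℝ≥0) ω - A ((0 : ℕ) : ℝ≥0) ω : ℕ) : ℝ) ∂P = r := by
      simpa [hA.zero] using hA.integral_eq 1
    rw [hlim] at hω
    refine hω.congr fun n => ?_
    rw [← Nat.cast_sum, hA.sum_increments hmono (by simp)]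
  · simpa [hA.zero] using hA.integrable 1
  · intro i j hij
    exact (hind.indepFun hij).comp (measurable_of_countable fun n : ℕ => (n : ℝ))
      (measurable_of_countable fun n : ℕ => (n : ℝ))
  · intro n
    exact ((hlaw n).identDistrib (hlaw 0)).comp (measurable_of_countable fun n : ℕ => (n : ℝ))

/-- Monotonicity squeezes `A t` between its values at ⌊t⌋ and ⌊t⌋ + 1. -/
theorem ae_tendsto_div (hA : IsPoissonProcess A r P) :
    ∀ᵐ ω ∂P, Tendsto (fun t : ℝ≥0 => (A t ω : ℝ) / t) atTop (𝓝 r) := by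
  filter_upwards [hA.ae_tendsto_div_nat] with ω hω
  have hfl : Tendsto (fun t : ℝ≥0 => ⌊t⌋₊) atTop atTop := tendsto_nat_floor_atTop
  have hcoe : Tendsto (fun t : ℝ≥0 => (t : ℝ)) atTop atTop := NNReal.tendsto_coe_atTop.2 tendsto_id
  have hinv : Tendsto (fun t : ℝ≥0 => (t : ℝ)⁻¹) atTop (𝓝 0) := hcoe.inv_tendsto_atTop
  have hratio : Tendsto (fun t : ℝ≥0 => (⌊t⌋₊ : ℝ) / t) atTop (𝓝 1) := by
    have := (tendsto_nat_floor_div_atTop (R := ℝ)).comp hcoe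
    have hfc : ∀ t : ℝ≥0, ⌊(t : ℝ)⌋₊ = ⌊t⌋₊ := fun t => Nonneg.nat_floor_coe t
    simpa [Function.comp_def, hfc] using this
  have hlow : Tendsto (fun t : ℝ≥0 => (A (⌊t⌋₊ : ℕ) ω : ℝ) / t) atTop (𝓝 r) := by
    have := (hω.comp hfl).mul hratio
    rw [mul_one] at this
    refine this.congr' ?_
    filter_upwards [eventually_ge_atTop 1] with t ht
    have : (⌊t⌋₊ : ℝ) ≠ 0 := by
      have := Nat.le_floor (n := 1) (a := t) (by simpa using ht)
      positivity
    simp only [Function.comp_apply]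
    field_simp
  have hup : Tendsto (fun t : ℝ≥0 => (A ((⌊t⌋₊ + 1 : ℕ) : ℝ≥0) ω : ℝ) / t) atTop (𝓝 r) := by
    have := (hω.comp ((tendsto_add_atTop_nat 1).comp hfl)).mul (hratio.add hinv)
    rw [add_zero, mul_one] at this
    refine this.congr' ?_
    filter_upwards [eventually_ge_atTop 1] with t ht
    have ht' : (t : ℝ) ≠ 0 := by
      have : (1 : ℝ) ≤ t := by exact_mod_cast ht
      positivity
    simp only [Function.comp_apply]
    push_cast
    field_simp
  refine tendsto_of_tendsto_of_tendsto_of_le_of_le hlow hup (fun t => ?_) (fun t => ?_)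
  · simp only
    gcongr
    exact hA.mono ω (Nat.floor_le zero_le)
  · simp only
    gcongr
    exact hA.mono ω (by push_cast; exact (Nat.lt_floor_add_one t).le)

end IsPoissonProcess

/-! ### The number of players modulo 4 -/

section Pair

variable {A₁ A₂ : ℝ≥0 → Ω → ℕ} {r₁ r₂ : ℝ≥0}

/-- The expectation factors. The team factor has norm at most 1 and may give no decay at all (z² = 1
when z = -1), so the rate comes from the individuals alone. -/
theorem norm_integral_pow_players_le (h₁ : IsPoissonProcess A₁ r₁ P)
    (h₂ : IsPoissonProcess A₂ r₂ P)
    (hind : IndepFun (fun ω t => A₁ t ω) (fun ω t => A₂ t ω) P)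
    {z : ℂ} (hz : ‖z‖ = 1) (s h : ℝ≥0) :
    ‖∫ ω, z ^ ((A₁ (s + h) ω + 2 * A₂ (s + h) ω) - (A₁ s ω + 2 * A₂ s ω)) ∂P‖
      ≤ Real.exp (-(r₁ * (1 - z.re)) * h) := by
  have heq : ∀ ω, z ^ ((A₁ (s + h) ω + 2 * A₂ (s + h) ω) - (A₁ s ω + 2 * A₂ s ω))
      = z ^ (A₁ (s + h) ω - A₁ s ω) * (z ^ 2) ^ (A₂ (s + h) ω - A₂ s ω) := by
    intro ω
    have l1 := h₁.mono ω (le_self_add : s ≤ s + h)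
    have l2 := h₂.mono ω (le_self_add : s ≤ s + h)
    simp only at l1 l2
    rw [← pow_mul, ← pow_add]
    congr 1
    omega
  have hI : IndepFun (fun ω => z ^ (A₁ (s + h) ω - A₁ s ω))
      (fun ω => (z ^ 2) ^ (A₂ (s + h) ω - A₂ s ω)) P :=
    hind.comp (φ := fun a : ℝ≥0 → ℕ => z ^ (a (s + h) - a s))
      (ψ := fun a : ℝ≥0 → ℕ => (z ^ 2) ^ (a (s + h) - a s))
      ((measurable_of_countable fun n : ℕ => z ^ n).comp
        ((measurable_pi_apply _).sub (measurable_pi_apply _)))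
      ((measurable_of_countable fun n : ℕ => (z ^ 2) ^ n).comp
        ((measurable_pi_apply _).sub (measurable_pi_apply _)))
  have hm : ∀ {A : ℝ≥0 → Ω → ℕ} {r : ℝ≥0}, IsPoissonProcess A r P → ∀ w : ℂ,
      AEStronglyMeasurable (fun ω => w ^ (A (s + h) ω - A s ω)) P := fun hA w =>
    ((measurable_of_countable fun n : ℕ => w ^ n).comp
      ((hA.measurable _).sub (hA.measurable _))).aestronglyMeasurable
  simp_rw [heq]
  rw [hI.integral_fun_mul_eq_mul_integral (hm h₁ z) (hm h₂ (z ^ 2)), h₁.integral_pow_sub,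
    h₂.integral_pow_sub, norm_mul, Complex.norm_exp, Complex.norm_exp]
  have hre : ((z ^ 2).re) ≤ 1 := (Complex.re_le_norm _).trans (by rw [norm_pow, hz, one_pow])
  have e1 : ((r₁ : ℂ) * h * (z - 1)).re = -(r₁ * (1 - z.re)) * h := by
    have : ((r₁ : ℂ) * h * (z - 1)) = ((r₁ * h : ℝ) : ℂ) * (z - 1) := by push_cast; ring
    rw [this, Complex.re_ofReal_mul, Complex.sub_re, Complex.one_re]
    ring
  have e2 : ((r₂ : ℂ) * h * (z ^ 2 - 1)).re ≤ 0 := by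
    have : ((r₂ : ℂ) * h * (z ^ 2 - 1)) = ((r₂ * h : ℝ) : ℂ) * (z ^ 2 - 1) := by push_cast; ring
    rw [this, Complex.re_ofReal_mul, Complex.sub_re, Complex.one_re]
    exact mul_nonpos_of_nonneg_of_nonpos (by positivity) (by linarith)
  rw [e1]
  exact mul_le_of_le_one_right (Real.exp_nonneg _) (Real.exp_le_one_iff.2 e2)

/-- On the unit circle, z^m times the conjugate of z^n is z^(m - n) for n ≤ m, so only the increment
matters. -/
theorem norm_integral_pow_mul_conj_le (h₁ : IsPoissonProcess A₁ r₁ P)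
    (h₂ : IsPoissonProcess A₂ r₂ P)
    (hind : IndepFun (fun ω t => A₁ t ω) (fun ω t => A₂ t ω) P)
    {z : ℂ} (hz : ‖z‖ = 1) (s u : ℝ≥0) :
    ‖∫ ω, z ^ (A₁ s ω + 2 * A₂ s ω) * conj (z ^ (A₁ u ω + 2 * A₂ u ω)) ∂P‖
      ≤ Real.exp (-(r₁ * (1 - z.re)) * |(s : ℝ) - u|) := by
  wlog hus : u ≤ s generalizing s u
  · have := this u s (le_of_not_ge hus)
    rw [abs_sub_comm, ← RCLike.norm_conj, ← integral_conj] at this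
    refine le_of_eq_of_le ?_ this
    congr 1
    refine integral_congr_ae (ae_of_all _ fun ω => ?_)
    simp [mul_comm]
  obtain ⟨h, rfl⟩ := exists_add_of_le hus
  have hzz : z * conj z = 1 := by rw [Complex.mul_conj, Complex.normSq_eq_norm_sq, hz]; simp
  have heq : ∀ ω, z ^ (A₁ (u + h) ω + 2 * A₂ (u + h) ω) * conj (z ^ (A₁ u ω + 2 * A₂ u ω))
      = z ^ ((A₁ (u + h) ω + 2 * A₂ (u + h) ω) - (A₁ u ω + 2 * A₂ u ω)) := by
    intro ω
    have l1 := h₁.mono ω hus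
    have l2 := h₂.mono ω hus
    simp only at l1 l2
    obtain ⟨d, hd⟩ := exists_add_of_le
      (show A₁ u ω + 2 * A₂ u ω ≤ A₁ (u + h) ω + 2 * A₂ (u + h) ω by omega)
    rw [hd, Nat.add_sub_cancel_left, pow_add, map_pow, mul_right_comm, ← mul_pow, hzz, one_pow,
      one_mul]
  simp_rw [heq]
  have := norm_integral_pow_players_le h₁ h₂ hind hz u h
  simpa using this

theorem measurable_players (h₁ : IsPoissonProcess A₁ r₁ P) (h₂ : IsPoissonProcess A₂ r₂ P) :
    Measurable fun p : ℝ × Ω => A₁ p.1.toNNReal p.2 + 2 * A₂ p.1.toNNReal p.2 :=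
  h₁.measurable_uncurry.add (h₂.measurable_uncurry.const_mul 2)

theorem ae_tendsto_average_pow [IsProbabilityMeasure P] (hr : 0 < r₁)
    (h₁ : IsPoissonProcess A₁ r₁ P)
    (h₂ : IsPoissonProcess A₂ r₂ P)
    (hind : IndepFun (fun ω t => A₁ t ω) (fun ω t => A₂ t ω) P)
    {z : ℂ} (hz : ‖z‖ = 1) (hz1 : z.re < 1) :
    ∀ᵐ ω ∂P, Tendsto (fun t : ℝ => (t : ℂ)⁻¹ * ∫ s in Set.Ioc 0 t,
      z ^ (A₁ s.toNNReal ω + 2 * A₂ s.toNNReal ω)) atTop (𝓝 0) := by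
  have hr' : (0 : ℝ) < r₁ := hr
  refine ae_tendsto_average_zero (c := r₁ * (1 - z.re))
    (X := fun s ω => z ^ (A₁ s.toNNReal ω + 2 * A₂ s.toNNReal ω))
    ((measurable_of_countable fun n : ℕ => z ^ n).comp (measurable_players h₁ h₂))
    (fun s ω => by rw [norm_pow, hz, one_pow]) (mul_pos hr' (by linarith)) fun s u hs hu => ?_
  have := norm_integral_pow_mul_conj_le h₁ h₂ hind hz s.toNNReal u.toNNReal
  rwa [Real.coe_toNNReal _ hs, Real.coe_toNNReal _ hu] at this

/-- In a unit interval, r individuals and no team arrive with positive probability for each r < 4,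
so every residue has probability at least some `m > 0`, independent of the interval; then `q = 1 -
m`. -/
theorem exists_measure_forall_not_dvd_le [IsProbabilityMeasure P] (hr : 0 < r₁)
    (h₁ : IsPoissonProcess A₁ r₁ P)
    (h₂ : IsPoissonProcess A₂ r₂ P)
    (hind : IndepFun (fun ω t => A₁ t ω) (fun ω t => A₂ t ω) P) :
    ∃ q : ℝ≥0∞, q < 1 ∧ ∀ (t : ℝ≥0) (n : ℕ),
      P {ω | ∀ k ≤ n, ¬ 4 ∣ A₁ (t + k) ω + 2 * A₂ (t + k) ω} ≤ q ^ n := by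
  set c : ℕ → ℝ≥0∞ := fun j => poissonMeasure (r₁ * 1) {j} * poissonMeasure (r₂ * 1) {0} with hc
  have hcpos : ∀ j, 0 < c j := by
    intro j
    refine ENNReal.mul_pos ?_ ?_
    · rw [poissonMeasure_singleton]
      have : (0 : ℝ) < r₁ := hr
      refine (ENNReal.ofReal_pos.2 ?_).ne'
      push_cast
      positivity
    · rw [poissonMeasure_singleton]
      refine (ENNReal.ofReal_pos.2 ?_).ne'
      simp only [pow_zero]
      positivity
  set m : ℝ≥0∞ := min (min (c 0) (c 1)) (min (c 2) (c 3)) with hm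
  have hmpos : 0 < m := by simp [hm, hcpos]
  refine ⟨1 - m, ENNReal.sub_lt_self ENNReal.one_ne_top one_ne_zero hmpos.ne', fun t n => ?_⟩
  -- With these times the zeroth increment is the count at `t`, later ones span unit intervals, and
  -- the first `k + 1` increments sum to the count at `t + k`.
  let τ : ℕ → ℝ≥0 := fun k => match k with
    | 0 => 0
    | k + 1 => t + k
  have hτ : Monotone τ := by
    refine monotone_nat_of_le_succ fun k => ?_
    rcases k with _ | k
    · exact zero_le
    · simp [τ]
  let D₁ : ℕ → Ω → ℕ := fun i ω => A₁ (τ (i + 1)) ω - A₁ (τ i) ω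
  let D₂ : ℕ → Ω → ℕ := fun i ω => A₂ (τ (i + 1)) ω - A₂ (τ i) ω
  have hD₁ : ∀ i, Measurable (D₁ i) := fun i => (h₁.measurable _).sub (h₁.measurable _)
  have hD₂ : ∀ i, Measurable (D₂ i) := fun i => (h₂.measurable _).sub (h₂.measurable _)
  have hDD : IndepFun (fun ω i => D₁ i ω) (fun ω i => D₂ i ω) P := by
    have hφ : Measurable fun (a : ℝ≥0 → ℕ) (i : ℕ) => a (τ (i + 1)) - a (τ i) :=
      measurable_pi_lambda _ fun i => (measurable_pi_apply _).sub (measurable_pi_apply _)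
    exact hind.comp hφ hφ
  have hi : iIndepFun (fun i ω => D₁ i ω + 2 * D₂ i ω) P := by
    have hpair : iIndepFun (fun i ω => (D₁ i ω, D₂ i ω)) P := by
      rw [iIndepFun_iff_finset]
      intro S
      have hres : Measurable fun (x : ℕ → ℕ) (i : S) => x i :=
        measurable_pi_lambda _ fun i => measurable_pi_apply _
      exact iIndepFun_prodMk (X := fun (i : S) => D₁ i) (Y := fun (i : S) => D₂ i)
        (fun i => hD₁ i) (fun i => hD₂ i)
        ((h₁.indepIncrements.nat hτ).precomp Subtype.val_injective)
        ((h₂.indepIncrements.nat hτ).precomp Subtype.val_injective) (hDD.comp hres hres)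
    exact hpair.comp (fun _ p => p.1 + 2 * p.2) fun _ => measurable_of_countable _
  have hq : ∀ n, ∀ r < 4, P {ω | (D₁ (n + 1) ω + 2 * D₂ (n + 1) ω) % 4 ≠ r} ≤ 1 - m := by
    intro n r hr4
    have hD : Measurable fun ω => D₁ (n + 1) ω + 2 * D₂ (n + 1) ω :=
      (hD₁ _).add ((hD₂ _).const_mul 2)
    have hms : MeasurableSet {ω | (D₁ (n + 1) ω + 2 * D₂ (n + 1) ω) % 4 = r} :=
      hD (Set.to_countable {d | d % 4 = r}).measurableSet
    have hcompl : {ω | (D₁ (n + 1) ω + 2 * D₂ (n + 1) ω) % 4 ≠ r}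
        = {ω | (D₁ (n + 1) ω + 2 * D₂ (n + 1) ω) % 4 = r}ᶜ := rfl
    rw [hcompl, prob_compl_eq_one_sub hms]
    refine tsub_le_tsub_left ?_ 1
    have hmc : m ≤ c r := by
      interval_cases r <;> simp [hm]
    refine hmc.trans ?_
    have hlaw : ∀ {A : ℝ≥0 → Ω → ℕ} {r : ℝ≥0}, IsPoissonProcess A r P → ∀ j,
        P ((fun ω => A (τ (n + 1 + 1)) ω - A (τ (n + 1)) ω) ⁻¹' {j})
          = poissonMeasure (r * 1) {j} := by
      intro A r hA j
      have hl := hA.law (t + n) 1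
      rw [← hl.map_eq, Measure.map_apply_of_aemeasurable hl.aemeasurable (measurableSet_singleton j)]
      simp [τ, add_assoc]
    have hI : IndepFun (D₁ (n + 1)) (D₂ (n + 1)) P :=
      hDD.comp (measurable_pi_apply (n + 1)) (measurable_pi_apply (n + 1))
    calc c r = P (D₁ (n + 1) ⁻¹' {r} ∩ D₂ (n + 1) ⁻¹' {0}) := by
          rw [hI.measure_inter_preimage_eq_mul _ _ (measurableSet_singleton r)
            (measurableSet_singleton 0), hc]
          simp only [D₁, D₂]
          rw [hlaw h₁, hlaw h₂]
      _ ≤ _ := by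
          refine measure_mono fun ω hω => ?_
          have e1 : D₁ (n + 1) ω = r := hω.1
          have e2 : D₂ (n + 1) ω = 0 := hω.2
          simp only [Set.mem_ofPred_eq, e1, e2]
          omega
  have h := measure_forall_not_dvd_le (D := fun i ω => D₁ i ω + 2 * D₂ i ω)
    (fun i => (hD₁ i).add ((hD₂ i).const_mul 2)) hi hq n
  convert h using 6 with ω k hk
  rw [Finset.sum_add_distrib, ← Finset.mul_sum, h₁.sum_increments hτ rfl,
    h₂.sum_increments hτ rfl]

end Pair

end Processes

/-! ### Fourier expansion on ℤ/4 and time averages -/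

/-- Expansion in the characters of ℤ/4; the real part accounts for the conjugate character (-i)^n,
and 3/2 is the mean. -/
theorem natCast_mod_four_eq (n : ℕ) :
    ((n % 4 : ℕ) : ℝ) = 3 / 2 +
      ((-1 / 2 : ℂ) * (-1) ^ n + (-1 + Complex.I) * Complex.I ^ n).re := by
  obtain ⟨q, r, hr, rfl⟩ : ∃ q r, r < 4 ∧ n = 4 * q + r :=
    ⟨n / 4, n % 4, Nat.mod_lt _ (by norm_num), (Nat.div_add_mod n 4).symm⟩
  rw [pow_add, pow_add, pow_mul, pow_mul, Complex.I_pow_four,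
    show (-1 : ℂ) ^ 4 = 1 by norm_num, one_pow, Nat.mul_add_mod, Nat.mod_eq_of_lt hr]
  interval_cases r <;> norm_num [pow_succ, Complex.div_re]

theorem indicator_four_dvd_eq (n : ℕ) :
    (if 4 ∣ n then 1 else 0 : ℝ) = 1 / 4 +
      ((1 / 4 : ℂ) * (-1) ^ n + (1 / 2) * Complex.I ^ n).re := by
  obtain ⟨q, r, hr, rfl⟩ : ∃ q r, r < 4 ∧ n = 4 * q + r :=
    ⟨n / 4, n % 4, Nat.mod_lt _ (by norm_num), (Nat.div_add_mod n 4).symm⟩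
  rw [pow_add, pow_add, pow_mul, pow_mul, Complex.I_pow_four,
    show (-1 : ℂ) ^ 4 = 1 by norm_num, one_pow]
  have hdvd : 4 ∣ 4 * q + r ↔ r = 0 := by omega
  simp only [hdvd]
  interval_cases r <;> norm_num [pow_succ, Complex.div_re]

section Average

variable {N : ℝ → ℕ}

theorem integrableOn_pow_comp (hN : Measurable N) {z : ℂ} (hz : ‖z‖ = 1) (t : ℝ) :
    IntegrableOn (fun s => z ^ N s) (Set.Ioc 0 t) :=
  Integrable.of_bound ((measurable_of_countable fun n : ℕ => z ^ n).comp hN).aestronglyMeasurable 1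
    (ae_of_all _ fun s => by simp [hz])

theorem tendsto_average_of_pow (hN : Measurable N)
    (h1 : Tendsto (fun t : ℝ => (t : ℂ)⁻¹ * ∫ s in Set.Ioc 0 t, (-1 : ℂ) ^ N s) atTop (𝓝 0))
    (h2 : Tendsto (fun t : ℝ => (t : ℂ)⁻¹ * ∫ s in Set.Ioc 0 t, Complex.I ^ N s) atTop (𝓝 0))
    {f : ℕ → ℝ} {κ : ℝ} {α β : ℂ}
    (hf : ∀ n, f n = κ + (α * (-1) ^ n + β * Complex.I ^ n).re) :
    Tendsto (fun t : ℝ => t⁻¹ * ∫ s in Set.Ioc 0 t, f (N s)) atTop (𝓝 κ) := by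
  have h3 := (Complex.continuous_re.tendsto _).comp ((h1.const_mul α).add (h2.const_mul β))
  have h4 := h3.const_add κ
  simp only [mul_zero, add_zero, Complex.zero_re] at h4
  refine h4.congr' ?_
  filter_upwards [eventually_gt_atTop 0] with t ht
  have i1 := integrableOn_pow_comp hN (z := -1) (by simp) t
  have i2 := integrableOn_pow_comp hN (z := Complex.I) (by simp) t
  have i3 : IntegrableOn (fun s => α * (-1) ^ N s + β * Complex.I ^ N s) (Set.Ioc 0 t) :=
    (i1.const_mul α).add (i2.const_mul β)
  have hi4 : IntegrableOn (fun s => (α * (-1) ^ N s + β * Complex.I ^ N s).re) (Set.Ioc 0 t) :=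
    i3.re
  simp_rw [hf]
  rw [integral_add (integrable_const κ) hi4]
  have hre : ∫ s in Set.Ioc 0 t, (α * (-1) ^ N s + β * Complex.I ^ N s).re
      = (α * (∫ s in Set.Ioc 0 t, (-1 : ℂ) ^ N s) + β * ∫ s in Set.Ioc 0 t, Complex.I ^ N s).re := by
    rw [← integral_const_mul, ← integral_const_mul,
      ← integral_add (i1.const_mul α) (i2.const_mul β)]
    exact integral_re i3
  rw [hre, mul_add]
  congr 1
  · simp [ht.le]
    field_simp
  · rw [Function.comp_apply, ← Complex.re_ofReal_mul]
    push_cast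
    congr 1
    ring

/-- The time `J t` spent at multiples of 4 grows like t/4, so it cannot stay constant on [t, (1 +
ε)t]. -/
theorem eventually_exists_four_dvd (hN : Measurable N)
    (h1 : Tendsto (fun t : ℝ => (t : ℂ)⁻¹ * ∫ s in Set.Ioc 0 t, (-1 : ℂ) ^ N s) atTop (𝓝 0))
    (h2 : Tendsto (fun t : ℝ => (t : ℂ)⁻¹ * ∫ s in Set.Ioc 0 t, Complex.I ^ N s) atTop (𝓝 0))
    {ε : ℝ} (hε : 0 < ε) :
    ∀ᶠ t : ℝ in atTop, ∃ T, t ≤ T ∧ T ≤ (1 + ε) * t ∧ 4 ∣ N T := by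
  have h := tendsto_average_of_pow hN h1 h2 (f := fun n => if 4 ∣ n then 1 else 0)
    indicator_four_dvd_eq
  set J : ℝ → ℝ := fun t => ∫ s in Set.Ioc 0 t, (if 4 ∣ N s then 1 else 0 : ℝ) with hJ
  have h' : Tendsto (fun t : ℝ => ((1 + ε) * t)⁻¹ * J ((1 + ε) * t)) atTop (𝓝 (1 / 4)) :=
    h.comp (tendsto_id.const_mul_atTop (by positivity))
  -- This is (J((1 + ε)t) - J(t))/t, with limit ε/4.
  have h'' := (h'.const_mul (1 + ε)).sub h
  have hpos : 0 < (1 + ε) * (1 / 4) - 1 / 4 := by linarith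
  filter_upwards [h''.eventually (lt_mem_nhds hpos), eventually_gt_atTop 0] with t ht ht0
  by_contra hcon
  push Not at hcon
  have htt : t ≤ (1 + ε) * t := by nlinarith
  have hint : ∀ a b : ℝ, IntegrableOn (fun s => (if 4 ∣ N s then 1 else 0 : ℝ)) (Set.Ioc a b) := by
    intro a b
    refine Integrable.of_bound ((measurable_of_countable fun n : ℕ =>
      (if 4 ∣ n then 1 else 0 : ℝ)).comp hN).aestronglyMeasurable 1 (ae_of_all _ fun s => ?_)
    split_ifs <;> simp
  have hJeq : J ((1 + ε) * t) = J t := by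
    simp only [hJ]
    rw [← Set.Ioc_union_Ioc_eq_Ioc ht0.le htt, setIntegral_union (Set.Ioc_disjoint_Ioc_of_le le_rfl)
      measurableSet_Ioc (hint _ _) (hint _ _)]
    rw [setIntegral_congr_fun (g := fun _ => (0 : ℝ)) (s := Set.Ioc t _) measurableSet_Ioc
      fun s hs => if_neg (hcon s hs.1.le hs.2)]
    simp
  rw [hJeq] at ht
  have : (1 + ε) * (((1 + ε) * t)⁻¹ * J t) - t⁻¹ * J t = 0 := by
    field_simp
    ring
  exact absurd ht (by rw [this]; exact lt_irrefl 0)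

theorem tendsto_lintegral_mod_four_div (hN : Measurable N)
    (h1 : Tendsto (fun t : ℝ => (t : ℂ)⁻¹ * ∫ s in Set.Ioc 0 t, (-1 : ℂ) ^ N s) atTop (𝓝 0))
    (h2 : Tendsto (fun t : ℝ => (t : ℂ)⁻¹ * ∫ s in Set.Ioc 0 t, Complex.I ^ N s) atTop (𝓝 0)) :
    Tendsto (fun t : ℝ≥0 => (∫⁻ s in Set.Ioc 0 (t : ℝ), ((N s % 4 : ℕ) : ℝ≥0∞)) / t) atTop
      (𝓝 (ENNReal.ofReal (3 / 2))) := by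
  have h := tendsto_average_of_pow hN h1 h2 (f := fun n => ((n % 4 : ℕ) : ℝ)) natCast_mod_four_eq
  have hcoe : Tendsto (fun t : ℝ≥0 => (t : ℝ)) atTop atTop := NNReal.tendsto_coe_atTop.2 tendsto_id
  refine (ENNReal.tendsto_ofReal (h.comp hcoe)).congr' ?_
  filter_upwards [eventually_gt_atTop 0] with t ht
  have ht' : (0 : ℝ) < t := ht
  have hm : Measurable fun s => ((N s % 4 : ℕ) : ℝ) :=
    (measurable_of_countable fun n : ℕ => ((n % 4 : ℕ) : ℝ)).comp hN
  rw [Function.comp_apply, mul_comm, ← div_eq_mul_inv, ENNReal.ofReal_div_of_pos ht',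
    ENNReal.ofReal_coe_nnreal, ofReal_integral_eq_lintegral_ofReal]
  · simp_rw [ENNReal.ofReal_natCast]
  · refine Integrable.of_bound hm.aestronglyMeasurable 4 (ae_of_all _ fun s => ?_)
    rw [Real.norm_natCast]
    exact_mod_cast (Nat.mod_lt (N s) (by norm_num : 0 < 4)).le
  · exact ae_of_all _ fun s => Nat.cast_nonneg _

end Average

/-! ### The limits, almost surely and in expectation -/

theorem tendsto_of_le_of_le_add {ι : Type*} {l : Filter ι} {f g : ι → ℝ≥0∞} {c : ℝ≥0∞}
    (hf : Tendsto f l (𝓝 c)) (h1 : ∀ᶠ t in l, f t ≤ g t)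
    (h2 : ∀ r : ℝ≥0, 0 < r → ∀ᶠ t in l, g t ≤ f t + r) : Tendsto g l (𝓝 c) := by
  refine tendsto_order.2 ⟨fun a ha => ?_, fun b hb => ?_⟩
  · filter_upwards [hf.eventually (lt_mem_nhds ha), h1] with t ht ht1
    exact ht.trans_le ht1
  · obtain ⟨r, hr, hrb⟩ := ENNReal.lt_iff_exists_add_pos_lt.1 hb
    have := hf.add_const (r : ℝ≥0∞)
    filter_upwards [this.eventually (gt_mem_nhds hrb), h2 r hr] with t ht ht2
    exact ht2.trans_lt ht

section Main

variable {Ω : Type*} [MeasurableSpace Ω] {P : Measure Ω}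
  {lam₁ lam₂ : ℝ≥0} {A₁ A₂ : ℝ≥0 → Ω → ℕ}

theorem measurable_queueIntegral (hA₁ : IsPoissonProcess A₁ lam₁ P)
    (hA₂ : IsPoissonProcess A₂ lam₂ P) (t : ℝ) :
    Measurable fun ω => queueIntegral (fun s => A₁ s ω) (fun s => A₂ s ω) t := by
  have : Measurable (Function.uncurry fun (ω : Ω) (s : ℝ) =>
      (((A₁ s.toNNReal ω + 2 * A₂ s.toNNReal ω) % 4 : ℕ) : ℝ≥0∞)) :=
    (measurable_of_countable fun n : ℕ => ((n % 4 : ℕ) : ℝ≥0∞)).comp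
      ((measurable_players hA₁ hA₂).comp measurable_swap)
  exact this.lintegral_prod_right'

theorem ae_tendsto_playersArrived_div (hA₁ : IsPoissonProcess A₁ lam₁ P)
    (hA₂ : IsPoissonProcess A₂ lam₂ P) :
    ∀ᵐ ω ∂P, Tendsto (fun t : ℝ≥0 => playersArrived (fun s => A₁ s ω) (fun s => A₂ s ω) t / t)
      atTop (𝓝 (ENNReal.ofReal (lam₁ + 2 * lam₂))) := by
  filter_upwards [hA₁.ae_tendsto_div, hA₂.ae_tendsto_div] with ω h1 h2
  refine (ENNReal.tendsto_ofReal (h1.add (h2.const_mul 2))).congr' ?_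
  filter_upwards [eventually_gt_atTop 0] with t ht
  have ht' : (0 : ℝ) < t := ht
  rw [playersArrived, ← ENNReal.ofReal_natCast, ← ENNReal.ofReal_coe_nnreal,
    ← ENNReal.ofReal_div_of_pos ht']
  congr 1
  push_cast
  ring

theorem lintegral_playersArrived (hA₁ : IsPoissonProcess A₁ lam₁ P)
    (hA₂ : IsPoissonProcess A₂ lam₂ P) (t : ℝ≥0) :
    ∫⁻ ω, playersArrived (fun s => A₁ s ω) (fun s => A₂ s ω) t ∂P
      = ENNReal.ofReal (lam₁ + 2 * lam₂) * t := by
  have hm : Measurable fun ω => (A₁ t ω : ℝ≥0∞) :=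
    (measurable_of_countable fun n : ℕ => (n : ℝ≥0∞)).comp (hA₁.measurable t)
  simp only [playersArrived, Nat.cast_add, Nat.cast_mul]
  rw [lintegral_add_left hm, lintegral_const_mul' _ _ (by simp), hA₁.lintegral_eq, hA₂.lintegral_eq,
    ENNReal.ofReal_add lam₁.coe_nonneg (by positivity), ENNReal.ofReal_mul (by norm_num),
    ENNReal.ofReal_coe_nnreal, ENNReal.ofReal_coe_nnreal]
  simp
  ring

theorem tendsto_div_of_tendsto_div_time {f g : ℝ≥0 → ℝ≥0∞} {l : ℝ} (hl : 0 < l)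
    (hf : Tendsto (fun t : ℝ≥0 => f t / t) atTop (𝓝 (ENNReal.ofReal (3 / 2))))
    (hg : Tendsto (fun t : ℝ≥0 => g t / t) atTop (𝓝 (ENNReal.ofReal l))) :
    Tendsto (fun t => f t / g t) atTop (𝓝 (ENNReal.ofReal (3 / (2 * l)))) := by
  have h := ENNReal.Tendsto.div hf (Or.inl (by simp)) hg (Or.inl ENNReal.ofReal_ne_top)
  rw [← ENNReal.ofReal_div_of_pos hl, div_div] at h
  refine h.congr' ?_
  filter_upwards [eventually_gt_atTop 0] with t ht
  simp only [div_eq_mul_inv _ (t : ℝ≥0∞)]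
  exact ENNReal.mul_div_mul_right _ _ (by simp) (by simpa using ht.ne')

variable [IsProbabilityMeasure P]

theorem ae_tendsto_average_queue (hlam₁ : 0 < lam₁)
    (hA₁ : IsPoissonProcess A₁ lam₁ P) (hA₂ : IsPoissonProcess A₂ lam₂ P)
    (hindep : IndepFun (fun ω t => A₁ t ω) (fun ω t => A₂ t ω) P) :
    ∀ᵐ ω ∂P,
      Tendsto (fun t : ℝ≥0 => queueIntegral (fun s => A₁ s ω) (fun s => A₂ s ω) t / t) atTop
        (𝓝 (ENNReal.ofReal (3 / 2))) ∧
      ∀ ε : ℝ≥0, 0 < ε → ∀ᶠ t : ℝ≥0 in atTop, ∃ T, t ≤ T ∧ T ≤ (1 + ε) * t ∧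
        4 ∣ A₁ T ω + 2 * A₂ T ω := by
  filter_upwards [ae_tendsto_average_pow hlam₁ hA₁ hA₂ hindep (z := -1) (by simp) (by norm_num),
    ae_tendsto_average_pow hlam₁ hA₁ hA₂ hindep (z := Complex.I) (by simp) (by simp)] with ω h1 h2
  have hN : Measurable fun s : ℝ => A₁ s.toNNReal ω + 2 * A₂ s.toNNReal ω :=
    (measurable_players hA₁ hA₂).comp (measurable_id.prodMk measurable_const)
  refine ⟨tendsto_lintegral_mod_four_div hN h1 h2, fun ε hε => ?_⟩
  have hcoe : Tendsto (fun t : ℝ≥0 => (t : ℝ)) atTop atTop := NNReal.tendsto_coe_atTop.2 tendsto_id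
  filter_upwards [hcoe.eventually (eventually_exists_four_dvd hN h1 h2 (ε := ε) hε)]
    with t ⟨T, h1T, h2T, h4⟩
  exact ⟨T.toNNReal, NNReal.le_toNNReal_of_coe_le h1T,
    Real.toNNReal_le_iff_le_coe.2 (by push_cast; exact h2T), h4⟩

theorem ae_tendsto_average_waiting (hlam₁ : 0 < lam₁)
    (hA₁ : IsPoissonProcess A₁ lam₁ P) (hA₂ : IsPoissonProcess A₂ lam₂ P)
    (hindep : IndepFun (fun ω t => A₁ t ω) (fun ω t => A₂ t ω) P) {games : Ω → Set Game}
    (hgames : ∀ᵐ ω ∂P, IsMatchmaking (fun t => A₁ t ω) (fun t => A₂ t ω) (games ω)) :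
    ∀ᵐ ω ∂P, Tendsto (fun t : ℝ≥0 =>
      totalWaitingTime (fun s => A₁ s ω) (fun s => A₂ s ω) (games ω) t / t) atTop
        (𝓝 (ENNReal.ofReal (3 / 2))) := by
  filter_upwards [ae_tendsto_average_queue hlam₁ hA₁ hA₂ hindep, hgames] with ω ⟨hS, hhit⟩ hM
  have c₁ := hA₁.isCountingPath ω
  have c₂ := hA₂.isCountingPath ω
  refine tendsto_of_le_of_le_add hS (Eventually.of_forall fun t => ?_) fun r hr => ?_
  · gcongr
    exact queueIntegral_le_totalWaitingTime c₁ c₂ hM t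
  · filter_upwards [hhit (r / 3) (by positivity), eventually_gt_atTop 0] with t ⟨T, htT, hTt, h4⟩ ht
    have hle := (totalWaitingTime_le_queueIntegral c₁ c₂ hM htT h4).trans
      (queueIntegral_le_add (t : ℝ) T t.2)
    have hgap : 3 * ENNReal.ofReal ((T : ℝ) - t) ≤ r * t := by
      have hTt' : (T : ℝ) ≤ (1 + r / 3) * t := by exact_mod_cast hTt
      have : ENNReal.ofReal ((T : ℝ) - t) ≤ ENNReal.ofReal (r * t / 3) :=
        ENNReal.ofReal_le_ofReal (by nlinarith)
      refine (mul_le_mul_right this 3).trans (le_of_eq ?_)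
      rw [show (3 : ℝ≥0∞) = ENNReal.ofReal 3 by simp, ← ENNReal.ofReal_mul (by norm_num),
        mul_div_cancel₀ _ (by norm_num), ENNReal.ofReal_mul r.coe_nonneg, ENNReal.ofReal_coe_nnreal,
        ENNReal.ofReal_coe_nnreal]
    have ht0 : (t : ℝ≥0∞) ≠ 0 := by exact_mod_cast ht.ne'
    rw [ENNReal.div_le_iff ht0 ENNReal.coe_ne_top, add_mul, ENNReal.div_mul_cancel ht0
      ENNReal.coe_ne_top]
    exact hle.trans (by gcongr)

/-- Dominated convergence with bound 3, the maximal queue length. -/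
theorem tendsto_lintegral_queueIntegral_div (hlam₁ : 0 < lam₁)
    (hA₁ : IsPoissonProcess A₁ lam₁ P) (hA₂ : IsPoissonProcess A₂ lam₂ P)
    (hindep : IndepFun (fun ω t => A₁ t ω) (fun ω t => A₂ t ω) P) :
    Tendsto (fun t : ℝ≥0 =>
      (∫⁻ ω, queueIntegral (fun s => A₁ s ω) (fun s => A₂ s ω) t ∂P) / t) atTop
        (𝓝 (ENNReal.ofReal (3 / 2))) := by
  have h := tendsto_lintegral_filter_of_dominated_convergence (μ := P) (l := atTop)
    (F := fun (t : ℝ≥0) ω => queueIntegral (fun s => A₁ s ω) (fun s => A₂ s ω) t / t)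
    (f := fun _ => ENNReal.ofReal (3 / 2)) (fun _ => 3)
    (Eventually.of_forall fun t => (measurable_queueIntegral hA₁ hA₂ t).div_const _)
    (Eventually.of_forall fun t => ae_of_all _ fun ω => ?_) (by simp)
    ((ae_tendsto_average_queue hlam₁ hA₁ hA₂ hindep).mono fun ω hω => hω.1)
  · simp only [lintegral_const, measure_univ, mul_one] at h
    refine h.congr fun t => ?_
    simp_rw [div_eq_mul_inv]
    rw [lintegral_mul_const _ (measurable_queueIntegral hA₁ hA₂ t)]
  · refine ENNReal.div_le_of_le_mul ?_
    have := queueIntegral_le_add (a₁ := fun s => A₁ s ω) (a₂ := fun s => A₂ s ω) 0 t le_rfl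
    simpa [queueIntegral] using this

/-- The number of integers `n` such that the queue is nonempty at the times `t, t + 1, ..., t + n`
bounds the time after `t` until the queue is empty, hence the remaining waiting times. -/
theorem totalWaitingTime_le_add_tsum {a₁ a₂ : ℝ≥0 → ℕ} {games : Set Game} (h₁ : IsCountingPath a₁)
    (h₂ : IsCountingPath a₂) (hM : IsMatchmaking a₁ a₂ games) (t : ℝ≥0) :
    totalWaitingTime a₁ a₂ games t ≤ queueIntegral a₁ a₂ t +
      3 * ∑' n : ℕ, if ∀ k ≤ n, ¬ 4 ∣ a₁ (t + k) + 2 * a₂ (t + k) then 1 else 0 := by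
  by_cases hex : ∃ k : ℕ, 4 ∣ a₁ (t + k) + 2 * a₂ (t + k)
  · refine (totalWaitingTime_le_queueIntegral h₁ h₂ hM (le_self_add (b := (Nat.find hex : ℝ≥0)))
      (Nat.find_spec hex)).trans ((queueIntegral_le_add (t : ℝ) _ t.2).trans ?_)
    gcongr
    refine le_trans ?_ (ENNReal.sum_le_tsum (Finset.range (Nat.find hex)))
    rw [Finset.sum_congr rfl fun n hn => if_pos fun k hk =>
      Nat.find_min hex (hk.trans_lt (Finset.mem_range.1 hn))]
    simp
  · push Not at hex
    simp [hex, ENNReal.mul_top]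

/-- The mean overshoot is at most 3 ∑ qⁿ = 3/(1 - q), uniformly in `t`. The almost sure bound εt
alone would not control expectations. -/
theorem exists_lintegral_totalWaitingTime_le (hlam₁ : 0 < lam₁)
    (hA₁ : IsPoissonProcess A₁ lam₁ P) (hA₂ : IsPoissonProcess A₂ lam₂ P)
    (hindep : IndepFun (fun ω t => A₁ t ω) (fun ω t => A₂ t ω) P) {games : Ω → Set Game}
    (hgames : ∀ᵐ ω ∂P, IsMatchmaking (fun t => A₁ t ω) (fun t => A₂ t ω) (games ω)) :
    ∃ C : ℝ≥0, ∀ t : ℝ≥0,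
      ∫⁻ ω, totalWaitingTime (fun s => A₁ s ω) (fun s => A₂ s ω) (games ω) t ∂P ≤
        (∫⁻ ω, queueIntegral (fun s => A₁ s ω) (fun s => A₂ s ω) t ∂P) + C := by
  obtain ⟨q, hq, hbound⟩ := exists_measure_forall_not_dvd_le hlam₁ hA₁ hA₂ hindep
  have hfin : 3 * (1 - q)⁻¹ ≠ ⊤ :=
    ENNReal.mul_ne_top (by simp) (ENNReal.inv_ne_top.2 (tsub_pos_of_lt hq).ne')
  refine ⟨(3 * (1 - q)⁻¹).toNNReal, fun t => ?_⟩
  rw [ENNReal.coe_toNNReal hfin]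
  set E : ℕ → Set Ω := fun n => {ω | ∀ k ≤ n, ¬ 4 ∣ A₁ (t + k) ω + 2 * A₂ (t + k) ω} with hE
  have hEm : ∀ n, MeasurableSet (E n) := by
    intro n
    have : E n = ⋂ (k : ℕ) (_ : k ≤ n), {ω | ¬ 4 ∣ A₁ (t + k) ω + 2 * A₂ (t + k) ω} := by
      ext ω
      simp [hE]
    rw [this]
    refine MeasurableSet.iInter fun k => MeasurableSet.iInter fun _ => ?_
    exact ((hA₁.measurable _).add ((hA₂.measurable _).const_mul 2))
      (Set.to_countable {m | ¬ 4 ∣ m}).measurableSet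
  calc ∫⁻ ω, totalWaitingTime (fun s => A₁ s ω) (fun s => A₂ s ω) (games ω) t ∂P
      ≤ ∫⁻ ω, (queueIntegral (fun s => A₁ s ω) (fun s => A₂ s ω) t
        + 3 * ∑' n, (E n).indicator (fun _ => 1) ω) ∂P := by
        refine lintegral_mono_ae (hgames.mono fun ω hM => ?_)
        refine (totalWaitingTime_le_add_tsum (hA₁.isCountingPath ω) (hA₂.isCountingPath ω) hM
          t).trans (le_of_eq ?_)
        congr 3
        ext n
        simp [Set.indicator_apply, hE]
    _ = (∫⁻ ω, queueIntegral (fun s => A₁ s ω) (fun s => A₂ s ω) t ∂P) + 3 * ∑' n, P (E n) := by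
        rw [lintegral_add_left (measurable_queueIntegral hA₁ hA₂ t), lintegral_const_mul' _ _ (by simp),
          lintegral_tsum fun n => (measurable_const.indicator (hEm n)).aemeasurable]
        simp_rw [lintegral_indicator_const (hEm _), one_mul]
    _ ≤ _ := by
        rw [← ENNReal.tsum_geometric]
        gcongr with n
        exact hbound t n

theorem tendsto_lintegral_totalWaitingTime_div (hlam₁ : 0 < lam₁)
    (hA₁ : IsPoissonProcess A₁ lam₁ P) (hA₂ : IsPoissonProcess A₂ lam₂ P)
    (hindep : IndepFun (fun ω t => A₁ t ω) (fun ω t => A₂ t ω) P) {games : Ω → Set Game}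
    (hgames : ∀ᵐ ω ∂P, IsMatchmaking (fun t => A₁ t ω) (fun t => A₂ t ω) (games ω)) :
    Tendsto (fun t : ℝ≥0 =>
      (∫⁻ ω, totalWaitingTime (fun s => A₁ s ω) (fun s => A₂ s ω) (games ω) t ∂P) / t) atTop
        (𝓝 (ENNReal.ofReal (3 / 2))) := by
  obtain ⟨C, hC⟩ := exists_lintegral_totalWaitingTime_le hlam₁ hA₁ hA₂ hindep hgames
  refine tendsto_of_le_of_le_add (tendsto_lintegral_queueIntegral_div hlam₁ hA₁ hA₂ hindep)
    (Eventually.of_forall fun t => ?_) fun r hr => ?_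
  · gcongr ?_ / _
    exact lintegral_mono_ae (hgames.mono fun ω hM =>
      queueIntegral_le_totalWaitingTime (hA₁.isCountingPath ω) (hA₂.isCountingPath ω) hM t)
  · filter_upwards [eventually_ge_atTop (C / r), eventually_gt_atTop 0] with t hCt ht
    have ht0 : (t : ℝ≥0∞) ≠ 0 := by exact_mod_cast ht.ne'
    rw [ENNReal.div_le_iff ht0 ENNReal.coe_ne_top, add_mul, ENNReal.div_mul_cancel ht0
      ENNReal.coe_ne_top]
    refine (hC t).trans ?_
    gcongr
    rw [← ENNReal.coe_mul, ENNReal.coe_le_coe, mul_comm]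
    exact (div_le_iff₀ hr).1 hCt

end Main

end TwoVTwo

theorem lemma2 {Ω : Type*} [MeasurableSpace Ω] (P : Measure Ω) [IsProbabilityMeasure P]
    (lam₁ lam₂ : ℝ≥0) (hlam₁ : 0 < lam₁)
    -- independent Poisson arrivals of individuals and of teams
    (A₁ A₂ : ℝ≥0 → Ω → ℕ)
    (hA₁ : TwoVTwo.IsPoissonProcess A₁ lam₁ P) (hA₂ : TwoVTwo.IsPoissonProcess A₂ lam₂ P)
    (hindep : IndepFun (fun ω t => A₁ t ω) (fun ω t => A₂ t ω) P)
    -- the games that an arbitrary prompt matchmaking mechanism (possibly randomized) starts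
    (games : Ω → Set TwoVTwo.Game)
    (hgames : ∀ᵐ ω ∂P, TwoVTwo.IsMatchmaking (fun t => A₁ t ω) (fun t => A₂ t ω) (games ω))
    (hmeas : ∀ p, AEMeasurable (fun ω => TwoVTwo.departure (games ω) p) P) :
    -- the average waiting time of the players who arrive up to time `t` converges almost surely
    (∀ᵐ ω ∂P, Tendsto
      (fun t : ℝ≥0 =>
        TwoVTwo.totalWaitingTime (fun s => A₁ s ω) (fun s => A₂ s ω) (games ω) t /
          TwoVTwo.playersArrived (fun s => A₁ s ω) (fun s => A₂ s ω) t)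
      atTop (𝓝 (ENNReal.ofReal (3 / (2 * ((lam₁ : ℝ) + 2 * (lam₂ : ℝ))))))) ∧
    -- the expected waiting time per player who arrives up to time `t` converges as well
    Tendsto
      (fun t : ℝ≥0 =>
        (∫⁻ ω, TwoVTwo.totalWaitingTime (fun s => A₁ s ω) (fun s => A₂ s ω) (games ω) t ∂P) /
          ∫⁻ ω, TwoVTwo.playersArrived (fun s => A₁ s ω) (fun s => A₂ s ω) t ∂P)
      atTop (𝓝 (ENNReal.ofReal (3 / (2 * ((lam₁ : ℝ) + 2 * (lam₂ : ℝ)))))) := by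
  have hl : (0 : ℝ) < (lam₁ : ℝ) + 2 * (lam₂ : ℝ) := by
    have : (0 : ℝ) < lam₁ := hlam₁
    positivity
  constructor
  · filter_upwards [TwoVTwo.ae_tendsto_average_waiting hlam₁ hA₁ hA₂ hindep hgames,
      TwoVTwo.ae_tendsto_playersArrived_div hA₁ hA₂] with ω hW hN
    exact TwoVTwo.tendsto_div_of_tendsto_div_time hl hW hN
  · refine TwoVTwo.tendsto_div_of_tendsto_div_time hl
      (TwoVTwo.tendsto_lintegral_totalWaitingTime_div hlam₁ hA₁ hA₂ hindep hgames)
      -- The mean number of players is exactly (λ₁ + 2λ₂)t, so this ratio is constant for t > 0.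
      (tendsto_const_nhds.congr' ?_)
    filter_upwards [eventually_gt_atTop 0] with t ht
    rw [TwoVTwo.lintegral_playersArrived hA₁ hA₂,
      ENNReal.mul_div_cancel_right (by simpa using ht.ne') ENNReal.coe_ne_top]
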